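/- Let $\mathcal A\subset\mathbb R^n$ be a finite set of nonzero, pairwise noncolinear vectors $\alpha$ with multiplicities $m_\alpha\in\mathbb Z_{\ge 0}$. Write $(x,y)=\sum_j x_jy_j$ and $x^2=(x,x)$ for $x,y\in\mathbb C^n$, and put $A_m(x)=\prod_{\alpha\in\mathcal A}(x,\alpha)^{m_\alpha}$, $|m|=\sum_{\alpha\in\mathcal A} m_\alpha$, $\Pi_\alpha=\{x\in\mathbb R^n:(x,\alpha)=0\}$, $\partial_\alpha=(\alpha,\partial/\partial x)$. Let $\phi(x,\lambda)$, $x,\lambda\in\mathbb C^n$, be a Baker–Akhiezer function associated to $\mathcal A$; that is: 1. for every $\lambda$, $\phi(x,\lambda)=P(x,\lambda)e^{(x,\lambda)}$, where $P(\cdot,\lambda)$ is a polynomial in $x$ of degree at most $|m|$ whose homogeneous part of degree $|m|$ is $A_m(x)A_m(\lambda)$; 2. for every $\lambda$ and every $\alpha\in\mathcal A$, $\partial_\alpha\phi(x,\lambda)=\partial_\alpha^3\phi(x,\lambda)=\cdots=\partial_\alpha^{2m_\alpha-1}\phi(x,\lambda)=0$ for all $x\in\Pi_\alpha$; 3. for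 every $x$, $\phi(x,\lambda)$ depends continuously on $\lambda$. Assume that $\phi(0,0)\neq 0$. Then for every $\xi\in\mathbb R^n\setminus\bigcup_{\alpha\in\mathcal A}\Pi_\alpha$ the integral below converges absolutely, and $$\phi(0,0)=\left(\int_{i\xi+\mathbb R^n}\frac{d\gamma(x)}{A_m(x)^2}\right)^{-1},\qquad d\gamma(x)=(2\pi)^{-n/2}e^{-x^2/2}\,dx .$$ -/

import Mathlib

open MeasureTheory

noncomputable section

namespace BakerAkhiezer

/-- The inclusion of `ℝⁿ` in `ℂⁿ`. -/
def toComplex {n : ℕ} (v : Fin n → ℝ) : Fin n → ℂ := fun i => (v i : ℂ)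

/-- A finite collection of pairwise noncolinear (nonzero) vectors in `ℝⁿ`, each with a
multiplicity. Only the values of `mult` on `vectors` matter. -/
structure Configuration (n : ℕ) where
  vectors : Finset (Fin n → ℝ)
  mult : (Fin n → ℝ) → ℕ
  ne_zero : ∀ α ∈ vectors, α ≠ 0
  noncolinear : ∀ α ∈ vectors, ∀ β ∈ vectors, α ≠ β → LinearIndependent ℝ ![α, β]

namespace Configuration

variable {n : ℕ} (A : Configuration n)

/-- `|m|`, the sum of all multiplicities. -/
def totalMult : ℕ := ∑ α ∈ A.vectors, A.mult α

/-- `A_m(x) = ∏ (x, α) ^ m_α` for `x` in `ℂⁿ`; the pairing is the complex bilinear extension of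
the standard inner product. -/
def Am (x : Fin n → ℂ) : ℂ := ∏ α ∈ A.vectors, (x ⬝ᵥ toComplex α) ^ A.mult α

/-- `A_m` as a polynomial in `x`. -/
def AmPoly : MvPolynomial (Fin n) ℂ :=
  ∏ α ∈ A.vectors, (∑ i, MvPolynomial.X i * MvPolynomial.C (α i : ℂ)) ^ A.mult α

theorem eval_AmPoly (x : Fin n → ℂ) : MvPolynomial.eval x A.AmPoly = A.Am x := by
  simp [AmPoly, Am, dotProduct, toComplex, map_prod, map_sum]

end Configuration

/-- The `k`-th directional derivative `(∂_α)^k f (x)`, where `∂_α = (α, ∂/∂x)`, of a function on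
`ℂⁿ`: the `k`-th derivative at `t = 0` of `t ↦ f (x + t α)`. -/
def dirDeriv {n : ℕ} (α : Fin n → ℝ) (k : ℕ) (f : (Fin n → ℂ) → ℂ) (x : Fin n → ℂ) : ℂ :=
  iteratedDeriv k (fun t : ℂ => f (x + t • toComplex α)) 0

/-- `φ(x, l)` is a (rational) Baker-Akhiezer function of the configuration `A`. -/
structure IsBakerAkhiezer {n : ℕ} (A : Configuration n)
    (φ : (Fin n → ℂ) → (Fin n → ℂ) → ℂ) : Prop where
  /-- `φ(x, l) = P(x, l) exp (x, l)` with `P` a polynomial in `x` of degree at most `|m|` whose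
  homogeneous part of degree `|m|` is `A_m(x) A_m(l)`. -/
  form : ∀ l : Fin n → ℂ, ∃ P : MvPolynomial (Fin n) ℂ,
    P.totalDegree ≤ A.totalMult ∧
    MvPolynomial.homogeneousComponent A.totalMult P = MvPolynomial.C (A.Am l) * A.AmPoly ∧
    ∀ x, φ x l = MvPolynomial.eval x P * Complex.exp (x ⬝ᵥ l)
  /-- `∂_α φ = ∂_α³ φ = ⋯ = ∂_α^(2 m_α - 1) φ = 0` on the hyperplane `(x, α) = 0` of `ℝⁿ`
  (the odd orders are `2 s + 1` with `s < m_α`). -/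
  quasi : ∀ l : Fin n → ℂ, ∀ α ∈ A.vectors, ∀ s < A.mult α, ∀ x : Fin n → ℝ, x ⬝ᵥ α = 0 →
    dirDeriv α (2 * s + 1) (fun y => φ y l) (toComplex x) = 0
  /-- `φ` depends continuously on the spectral parameter `l`. Without this, the two conditions above
  do not determine `φ(·, l)` for the exceptional `l` with `A_m(l) = 0`, such as `l = 0`. -/
  continuous_param : ∀ x : Fin n → ℂ, Continuous (fun l => φ x l)

/-- The point `y + i ξ` of the affine subspace `i ξ + ℝⁿ` of `ℂⁿ`. -/
def shift {n : ℕ} (ξ y : Fin n → ℝ) : Fin n → ℂ := toComplex y + Complex.I • toComplex ξ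

/-- The density `(2π)^(-n/2) exp (-x²/2)`, `x² = x₁² + ⋯ + xₙ²`, of the Gaussian measure `dγ(x)`
with respect to `dx`, at `x` in `ℂⁿ`. -/
def gaussianDensity {n : ℕ} (x : Fin n → ℂ) : ℂ :=
  (((2 * Real.pi) ^ (-(n : ℝ) / 2) : ℝ) : ℂ) * Complex.exp (-(x ⬝ᵥ x) / 2)

/-- `F` is absolutely integrable over `i ξ + ℝⁿ` with respect to `γ`. -/
def GaussianIntegrable {n : ℕ} (ξ : Fin n → ℝ) (F : (Fin n → ℂ) → ℂ) : Prop :=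
  Integrable (fun y : Fin n → ℝ => F (shift ξ y) * gaussianDensity (shift ξ y)) volume

/-- `∫ F(x) dγ(x)` over `i ξ + ℝⁿ`. -/
def gaussianIntegral {n : ℕ} (ξ : Fin n → ℝ) (F : (Fin n → ℂ) → ℂ) : ℂ :=
  ∫ y : Fin n → ℝ, F (shift ξ y) * gaussianDensity (shift ξ y)

end BakerAkhiezer

end

/-!
Fix `ξ` and put `J(s) = ∫ φ(s ξ, z) A_m(z)⁻² dγ(z)` over `i ξ + ℝⁿ`, so that `J(0)` is `φ(0, 0)`
times the integral of the theorem. As a function of the spectral variable, `φ(x, ·)` satisfies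
`Δ φ - 2 (∇ log A_m, ∇ φ) = x² φ`. Integrating the derivative of `J` by parts against the Gaussian
turns this equation into `J'(s) = s ξ² J(s)`, hence `exp (-s² ξ² / 2) J(s)` is constant. Translating
the Gaussian by `s ξ` shows that only the leading term `A_m(x) A_m(λ)` contributes as `s → ∞`, where
it gives `1`. Therefore `J(0) = 1`.

For the equation, `φ` is first shown to be polynomial in both variables up to the exponential. The
quasi-invariance conditions on polynomials `p(x)` of degree at most `|m|` determine `p` up to a
scalar. The defect of the equation satisfies them, so it is a multiple of `φ`; at `x = 0`, where
`φ(0, ·) = φ(0, 0) ≠ 0` is constant, it vanishes.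
-/

noncomputable section

namespace BakerAkhiezer

open MvPolynomial Filter Topology

section Homogeneity

variable {R σ τ : Type*}

/-- The restriction `t ↦ p(t x)` of a polynomial to the line through the origin and `x`. -/
def alongLine [CommSemiring R] (x : σ → R) : MvPolynomial σ R →ₐ[R] Polynomial R :=
  aeval fun i => Polynomial.C (x i) * Polynomial.X

theorem alongLine_monomial [CommSemiring R] (x : σ → R) (a : σ →₀ ℕ) (r : R) :
    alongLine x (monomial a r) =
      Polynomial.C (eval x (monomial a r)) * Polynomial.X ^ a.degree := by
  simp only [alongLine, aeval_monomial, eval_monomial, mul_pow, Finsupp.prod_mul, map_mul,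
    mul_assoc, Polynomial.algebraMap_eq, ← map_pow, map_finsuppProd]
  simp only [Finsupp.prod, Finset.prod_pow_eq_pow_sum, Finsupp.degree_apply]

theorem eval_alongLine [CommSemiring R] (x : σ → R) (t : R) (p : MvPolynomial σ R) :
    (alongLine x p).eval t = eval (t • x) p := by
  induction p using MvPolynomial.induction_on with
  | C r => simp [alongLine]
  | add p q hp hq => simp [hp, hq]
  | mul_X p i hp =>
    rw [map_mul, map_mul, Polynomial.eval_mul, hp]
    simp [alongLine, mul_comm (x i) t]

theorem coeff_alongLine [CommSemiring R] (x : σ → R) (k : ℕ) (p : MvPolynomial σ R) :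
    (alongLine x p).coeff k = eval x (homogeneousComponent k p) := by
  induction p using MvPolynomial.induction_on' with
  | monomial a r =>
    rw [alongLine_monomial, Polynomial.coeff_C_mul_X_pow]
    split_ifs with h
    · rw [homogeneousComponent_eq_self (isHomogeneous_monomial r h.symm)]
    · rw [homogeneousComponent_of_mem (isHomogeneous_monomial r rfl), if_neg h, map_zero]
  | add p q hp hq => simp [hp, hq]

theorem eval_homogeneousComponent_eq_of_forall_smul {p : MvPolynomial σ ℂ} {q : MvPolynomial τ ℂ}
    {x : σ → ℂ} {y : τ → ℂ} (h : ∀ t : ℝ, t ≠ 0 → eval ((t : ℂ) • x) p = eval ((t : ℂ) • y) q)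
    (k : ℕ) :
    eval x (homogeneousComponent k p) = eval y (homogeneousComponent k q) := by
  have hline : alongLine x p = alongLine y q := by
    refine Polynomial.eq_of_infinite_eval_eq _ _
      (((Set.finite_singleton (0 : ℝ)).infinite_compl.image Complex.ofReal_injective.injOn).mono ?_)
    rintro _ ⟨t, ht, rfl⟩
    simpa only [Set.mem_ofPred_eq, eval_alongLine] using h t ht
  rw [← coeff_alongLine, hline, coeff_alongLine]

theorem homogeneousComponent_pderiv [CommSemiring R] (i : σ) (k : ℕ) (p : MvPolynomial σ R) :
    homogeneousComponent k (pderiv i p) = pderiv i (homogeneousComponent (k + 1) p) := by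
  ext a
  simp [coeff_homogeneousComponent, coeff_pderiv]

theorem homogeneousComponent_totalDegree_ne_zero [CommSemiring R] {p : MvPolynomial σ R}
    (hp : p ≠ 0) : homogeneousComponent p.totalDegree p ≠ 0 := by
  obtain ⟨a, ha, hdeg⟩ := Finset.exists_mem_eq_sup p.support (support_nonempty.2 hp)
    fun s => s.sum fun _ e => e
  intro h
  have hcoeff := congrArg (coeff a) h
  rw [coeff_homogeneousComponent, if_pos (show a.degree = p.totalDegree from hdeg.symm),
    coeff_zero] at hcoeff
  exact mem_support_iff.1 ha hcoeff

theorem totalDegree_X_mul_le_of_homogeneousComponent_eq_zero [CommSemiring R]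
    {p : MvPolynomial σ R} {d : ℕ} (hd : p.totalDegree ≤ d) (htop : homogeneousComponent d p = 0)
    (i : σ) : (X i * p).totalDegree ≤ d := by
  rcases eq_or_ne p 0 with rfl | hp
  · simp
  have hlt : p.totalDegree < d :=
    hd.lt_of_ne fun h => homogeneousComponent_totalDegree_ne_zero hp (h ▸ htop)
  have hX := (isHomogeneous_X R i).totalDegree_le
  exact (totalDegree_mul _ _).trans (by omega)

/-- The substitution `x ↦ t x` in a polynomial. -/
def rescale [CommSemiring R] (t : R) : MvPolynomial σ R →ₐ[R] MvPolynomial σ R :=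
  aeval fun i => C t * X i

theorem eval_rescale [CommSemiring R] (t : R) (p : MvPolynomial σ R) (x : σ → R) :
    eval x (rescale t p) = eval (t • x) p := by
  induction p using MvPolynomial.induction_on with
  | C r => simp [rescale]
  | add p q hp hq => simp [hp, hq]
  | mul_X p i hp =>
    rw [map_mul, map_mul, map_mul, hp]
    simp [rescale]

theorem coeff_rescale [CommSemiring R] (t : R) (p : MvPolynomial σ R) (a : σ →₀ ℕ) :
    coeff a (rescale t p) = t ^ a.degree * coeff a p := by
  classical
  induction p using MvPolynomial.induction_on' with
  | monomial b r =>
    have hb : rescale t (monomial b r) = monomial b (t ^ b.degree * r) := by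
      simp only [rescale, aeval_monomial, mul_pow, Finsupp.prod_mul, algebraMap_eq]
      rw [monomial_eq, C_mul, map_pow]
      simp only [Finsupp.prod, Finset.prod_pow_eq_pow_sum, Finsupp.degree_apply]
      ring
    rw [hb, coeff_monomial, coeff_monomial]
    split_ifs with h
    · rw [h]
    · rw [mul_zero]
  | add p q hp hq => simp [hp, hq, mul_add]

theorem totalDegree_rescale_le [CommSemiring R] (t : R) (p : MvPolynomial σ R) :
    (rescale t p).totalDegree ≤ p.totalDegree := by
  refine Finset.sup_mono fun a ha => ?_
  rw [mem_support_iff, coeff_rescale] at ha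
  exact mem_support_iff.2 (right_ne_zero_of_mul ha)

theorem homogeneousComponent_rescale [CommSemiring R] (t : R) (k : ℕ) (p : MvPolynomial σ R) :
    homogeneousComponent k (rescale t p) = C (t ^ k) * homogeneousComponent k p := by
  ext a
  rw [coeff_C_mul, coeff_homogeneousComponent, coeff_homogeneousComponent, coeff_rescale]
  split_ifs with h
  · rw [h]
  · rw [mul_zero]

theorem pderiv_rescale [CommSemiring R] (t : R) (i : σ) (p : MvPolynomial σ R) :
    pderiv i (rescale t p) = C t * rescale t (pderiv i p) := by
  classical
  ext a
  simp only [coeff_C_mul, coeff_pderiv, coeff_rescale, map_add, Finsupp.degree_single, pow_succ]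
  ring

theorem eval_smul_eq_sum [CommSemiring R] {d : ℕ} {p : MvPolynomial σ R} (hp : p.totalDegree ≤ d)
    (c : R) (x : σ → R) :
    eval (c • x) p = ∑ k ∈ Finset.range (d + 1), c ^ k * eval x (homogeneousComponent k p) := by
  have hdeg : (alongLine x p).natDegree ≤ d :=
    Polynomial.natDegree_le_iff_coeff_eq_zero.2 fun k hk => by
      rw [coeff_alongLine, homogeneousComponent_eq_zero _ _ (hp.trans_lt hk), map_zero]
  simp only [← eval_alongLine, Polynomial.eval_eq_sum_range' (Nat.lt_succ_of_le hdeg),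
    coeff_alongLine, mul_comm]

end Homogeneity

section LinearForms

variable {R : Type*} [CommSemiring R] {n : ℕ}

/-- The linear form `(x, α)` as a polynomial in `x`. -/
def linForm (α : Fin n → R) : MvPolynomial (Fin n) R := ∑ i, X i * C (α i)

theorem eval_linForm (α x : Fin n → R) : eval x (linForm α) = x ⬝ᵥ α := by
  simp [linForm, dotProduct]

theorem isHomogeneous_linForm (α : Fin n → R) : (linForm α).IsHomogeneous 1 :=
  IsHomogeneous.sum _ _ _ fun i _ => (isHomogeneous_X R i).mul (isHomogeneous_C (Fin n) (α i))

end LinearForms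

section RealHyperplanes

variable {n : ℕ} {α β : Fin n → ℝ}

theorem toComplex_dotProduct (y α : Fin n → ℝ) :
    toComplex y ⬝ᵥ toComplex α = ((y ⬝ᵥ α : ℝ) : ℂ) := by
  simp [dotProduct, toComplex]

theorem toComplex_smul (t : ℝ) (y : Fin n → ℝ) : toComplex (t • y) = (t : ℂ) • toComplex y := by
  ext i
  simp [toComplex]

theorem dotProduct_self_ne_zero (hα : α ≠ 0) : α ⬝ᵥ α ≠ 0 :=
  mt dotProduct_self_eq_zero.1 hα

theorem linForm_ne_zero (hα : α ≠ 0) : linForm (toComplex α) ≠ 0 := by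
  intro h
  have hself := eval_linForm (toComplex α) (toComplex α)
  rw [h, map_zero, toComplex_dotProduct] at hself
  exact dotProduct_self_ne_zero hα (by exact_mod_cast hself.symm)

theorem sub_smul_dotProduct_eq_zero (hα : α ≠ 0) (y : Fin n → ℝ) :
    (y - (y ⬝ᵥ α / α ⬝ᵥ α) • α) ⬝ᵥ α = 0 := by
  rw [sub_dotProduct, smul_dotProduct, smul_eq_mul, div_mul_cancel₀ _ (dotProduct_self_ne_zero hα),
    sub_self]

theorem eq_zero_of_eval_toComplex {p : MvPolynomial (Fin n) ℂ}
    (h : ∀ y : Fin n → ℝ, eval (toComplex y) p = 0) : p = 0 := by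
  refine funext_set (fun _ => Set.range ((↑) : ℝ → ℂ))
    (fun _ => Set.infinite_range_of_injective Complex.ofReal_injective) fun x hx => ?_
  choose y hy using fun i => hx i (Set.mem_univ i)
  rw [map_zero, ← h y, show toComplex y = x from _root_.funext hy]

theorem linForm_dvd_of_eval_eq_zero (hα : α ≠ 0) {p : MvPolynomial (Fin n) ℂ}
    (h : ∀ y : Fin n → ℝ, y ⬝ᵥ α = 0 → eval (toComplex y) p = 0) : linForm (toComplex α) ∣ p := by
  -- the pullback of `p` along the orthogonal projection to the hyperplane
  let proj : MvPolynomial (Fin n) ℂ →ₐ[ℂ] MvPolynomial (Fin n) ℂ :=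
    aeval fun i => X i - linForm (toComplex α) * C ((α i / α ⬝ᵥ α : ℝ) : ℂ)
  have hproj : proj p = 0 := eq_zero_of_eval_toComplex fun y => by
    have hcomp : (aeval (toComplex y)).comp proj =
        aeval (toComplex (y - (y ⬝ᵥ α / α ⬝ᵥ α) • α)) := by
      ext i
      simp [proj, eval_linForm, toComplex_dotProduct, toComplex]
      ring
    exact (DFunLike.congr_fun hcomp p).trans (h _ (sub_smul_dotProduct_eq_zero hα y))
  let π := Ideal.Quotient.mkₐ ℂ (Ideal.span {linForm (toComplex α)})
  have hπ : π (linForm (toComplex α)) = 0 :=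
    Ideal.Quotient.eq_zero_iff_mem.2 (Ideal.mem_span_singleton_self _)
  have hmod : π.comp proj = π := by
    ext i
    simp [proj, hπ]
  have hp : π p = 0 := by rw [← hmod, AlgHom.comp_apply, hproj, map_zero]
  exact Ideal.mem_span_singleton.1 (Ideal.Quotient.eq_zero_iff_mem.1 hp)

theorem irreducible_linForm (hα : α ≠ 0) : Irreducible (linForm (toComplex α)) := by
  refine irreducible_of_totalDegree_eq_one
    ((isHomogeneous_linForm (toComplex α)).totalDegree (linForm_ne_zero hα)) fun x hx => ?_
  rw [isUnit_iff_ne_zero]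
  rintro rfl
  exact linForm_ne_zero hα (by ext i; simpa using hx i)

theorem isRelPrime_linForm (hα : α ≠ 0) (h : LinearIndependent ℝ ![α, β]) :
    IsRelPrime (linForm (toComplex α)) (linForm (toComplex β)) := by
  rw [(irreducible_linForm hα).isRelPrime_iff_not_dvd]
  rintro ⟨q, hq⟩
  set y : Fin n → ℝ := β - (β ⬝ᵥ α / α ⬝ᵥ α) • α with hy
  have hyα : y ⬝ᵥ α = 0 := sub_smul_dotProduct_eq_zero hα β
  have hyβ : y ⬝ᵥ β = 0 := by
    have heval := congrArg (eval (toComplex y)) hq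
    rw [map_mul, eval_linForm, eval_linForm, toComplex_dotProduct, toComplex_dotProduct, hyα,
      Complex.ofReal_zero, zero_mul] at heval
    exact_mod_cast heval
  have hyy : y ⬝ᵥ y = 0 := by
    nth_rw 2 [hy]
    rw [dotProduct_sub, dotProduct_smul, hyα, hyβ, smul_zero, sub_zero]
  have hrel : -(β ⬝ᵥ α / α ⬝ᵥ α) • α + (1 : ℝ) • β = 0 := by
    rw [one_smul, neg_smul, neg_add_eq_sub]
    exact dotProduct_self_eq_zero.1 hyy
  exact one_ne_zero (LinearIndependent.pair_iff.1 h _ _ hrel).2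

end RealHyperplanes

section DirectionalDerivation

variable {R : Type*} [CommSemiring R] {n : ℕ}

/-- The derivation `∂_α = ∑ αᵢ ∂/∂xᵢ` of the polynomial ring. -/
def dirDerivation (α : Fin n → R) :
    Derivation R (MvPolynomial (Fin n) R) (MvPolynomial (Fin n) R) :=
  mkDerivation R fun i => C (α i)

theorem dirDerivation_X (α : Fin n → R) (i : Fin n) : dirDerivation α (X i) = C (α i) :=
  mkDerivation_X _ _ _

theorem dirDerivation_apply (α : Fin n → R) (p : MvPolynomial (Fin n) R) :
    dirDerivation α p = ∑ i, C (α i) * pderiv i p := by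
  classical
  induction p using MvPolynomial.induction_on with
  | C r => simp [dirDerivation]
  | add p q hp hq => simp [hp, hq, mul_add, Finset.sum_add_distrib]
  | mul_X p j hp =>
    simp [Derivation.leibniz, hp, dirDerivation_X, pderiv_X, Pi.single_apply, mul_add,
      Finset.sum_add_distrib, Finset.mul_sum, mul_comm, mul_left_comm]

theorem map_dirDerivation {S : Type*} [CommSemiring S] (f : R →+* S) (α : Fin n → R)
    (p : MvPolynomial (Fin n) R) :
    map f (dirDerivation α p) = dirDerivation (f ∘ α) (map f p) := by
  simp only [dirDerivation_apply, map_sum, map_mul, map_C, pderiv_map, Function.comp_apply]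

theorem homogeneousComponent_iterate_dirDerivation (α : Fin n → R) (j k : ℕ)
    (p : MvPolynomial (Fin n) R) : homogeneousComponent k ((dirDerivation α)^[j] p) =
      (dirDerivation α)^[j] (homogeneousComponent (k + j) p) := by
  induction j generalizing k p with
  | zero => rfl
  | succ j ih =>
    rw [Function.iterate_succ_apply, ih, Function.iterate_succ_apply]
    congr 1
    simp only [dirDerivation_apply, map_sum, homogeneousComponent_C_mul,
      homogeneousComponent_pderiv, add_assoc]

theorem iterate_dirDerivation_eq_zero (α : Fin n → R) {j : ℕ} {p : MvPolynomial (Fin n) R}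
    (hj : p.totalDegree < j) : (dirDerivation α)^[j] p = 0 := by
  rw [← sum_homogeneousComponent ((dirDerivation α)^[j] p)]
  refine Finset.sum_eq_zero fun k _ => ?_
  rw [homogeneousComponent_iterate_dirDerivation, homogeneousComponent_eq_zero _ _ (by omega),
    iterate_map_zero]

end DirectionalDerivation

section Commutators

theorem pow_mul_of_commutators {R : Type*} [Semiring R] {T L D E : R} (hL : T * L = L * T + D)
    (hD : T * D = D * T + E) (hE : Commute T E) (k : ℕ) :
    T ^ k * L = L * T ^ k + k • (D * T ^ (k - 1)) + k.choose 2 • (E * T ^ (k - 2)) := by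
  induction k with
  | zero => simp
  | succ k ih =>
    have hDk : k • (T * D * T ^ (k - 1)) = k • (D * T ^ k + E * T ^ (k - 1)) := by
      rcases k with _ | k
      · simp
      · rw [hD, add_mul, mul_assoc, Nat.add_sub_cancel, ← pow_succ']
    have hEk : k.choose 2 • (T * E * T ^ (k - 2)) = k.choose 2 • (E * T ^ (k - 1)) := by
      rcases k with _ | _ | k
      · simp
      · simp
      · rw [hE.eq, mul_assoc, ← pow_succ']
        rfl
    rw [pow_succ', mul_assoc, ih, mul_add, mul_add, mul_smul_comm, mul_smul_comm, ← mul_assoc,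
      ← mul_assoc, ← mul_assoc, hL, hDk, hEk, add_mul, mul_assoc, ← pow_succ', smul_add,
      Nat.add_sub_cancel, show k + 1 - 2 = k - 1 by omega, Nat.choose_succ_succ' k 1,
      Nat.choose_one_right, add_smul k 1, one_smul, add_smul]
    abel

end Commutators

section Twist

variable {R : Type*} [CommSemiring R] {n : ℕ}

/-- The operator `∂_α + (α, l)`, that is, `∂_α` conjugated by `exp (x, l)`. -/
def twist (α l : Fin n → R) : Module.End R (MvPolynomial (Fin n) R) :=
  (dirDerivation α : MvPolynomial (Fin n) R →ₗ[R] MvPolynomial (Fin n) R) + (l ⬝ᵥ α) • 1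

theorem twist_apply (α l : Fin n → R) (p : MvPolynomial (Fin n) R) :
    twist α l p = dirDerivation α p + (l ⬝ᵥ α) • p := rfl

theorem twist_pow_apply (α l : Fin n → R) (k : ℕ) (p : MvPolynomial (Fin n) R) :
    (twist α l ^ k) p = ∑ j ∈ Finset.range (k + 1),
      ((l ⬝ᵥ α) ^ (k - j) * (k.choose j : R)) • (dirDerivation α)^[j] p := by
  have hc : Commute (dirDerivation α : MvPolynomial (Fin n) R →ₗ[R] MvPolynomial (Fin n) R)
      ((l ⬝ᵥ α) • (1 : Module.End R (MvPolynomial (Fin n) R))) :=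
    (Commute.one_right _).smul_right _
  rw [twist, hc.add_pow, LinearMap.sum_apply]
  refine Finset.sum_congr rfl fun j _ => ?_
  rw [smul_pow, one_pow]
  simp only [Module.End.mul_apply, LinearMap.smul_apply, Module.End.one_apply,
    Module.End.natCast_apply, map_smul, map_nsmul, Module.End.pow_apply]
  rw [mul_smul, Nat.cast_smul_eq_nsmul, smul_comm]
  rfl

theorem map_twist_pow {S : Type*} [CommSemiring S] (f : R →+* S) (α l : Fin n → R) (k : ℕ)
    (p : MvPolynomial (Fin n) R) :
    map f ((twist α l ^ k) p) = (twist (f ∘ α) (f ∘ l) ^ k) (map f p) := by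
  induction k with
  | zero => rfl
  | succ k ih =>
    rw [pow_succ', pow_succ', Module.End.mul_apply, Module.End.mul_apply, ← ih, twist_apply,
      twist_apply, map_add, map_dirDerivation, smul_eq_C_mul, smul_eq_C_mul, map_mul, map_C,
      RingHom.map_dotProduct]

theorem dirDerivation_linForm (α β : Fin n → R) : dirDerivation α (linForm β) = C (α ⬝ᵥ β) := by
  simp [linForm, dirDerivation_X, dotProduct, mul_comm]

theorem dirDerivation_sum_X_sq (α : Fin n → R) :
    dirDerivation α (∑ i, X i ^ 2) = 2 * linForm α := by
  simp only [map_sum, Derivation.leibniz_pow, dirDerivation_X, linForm, Finset.mul_sum, smul_eq_mul,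
    nsmul_eq_mul, pow_one, Nat.add_one_sub_one, Nat.cast_ofNat]

theorem twist_mul_mulLeft (α l : Fin n → R) (q : MvPolynomial (Fin n) R) :
    twist α l * LinearMap.mulLeft R q =
      LinearMap.mulLeft R q * twist α l + LinearMap.mulLeft R (dirDerivation α q) := by
  refine LinearMap.ext fun p => ?_
  simp only [Module.End.mul_apply, LinearMap.add_apply, LinearMap.mulLeft_apply, twist_apply,
    Derivation.leibniz, smul_eq_mul, smul_eq_C_mul]
  ring

theorem twist_pow_linForm_mul (α l β : Fin n → R) (k : ℕ) (p : MvPolynomial (Fin n) R) :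
    (twist α l ^ k) (linForm β * p) =
      linForm β * (twist α l ^ k) p + k • (C (α ⬝ᵥ β) * (twist α l ^ (k - 1)) p) := by
  have hL := twist_mul_mulLeft α l (linForm β)
  rw [dirDerivation_linForm] at hL
  have hD := twist_mul_mulLeft α l (C (α ⬝ᵥ β))
  rw [derivation_C, LinearMap.mulLeft_zero_eq_zero] at hD
  simpa using LinearMap.congr_fun (pow_mul_of_commutators hL hD (Commute.zero_right _) k) p

theorem twist_pow_sum_X_sq_mul (α l : Fin n → R) (k : ℕ) (p : MvPolynomial (Fin n) R) :
    (twist α l ^ k) ((∑ i, X i ^ 2) * p) =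
      (∑ i, X i ^ 2) * (twist α l ^ k) p + k • (2 * linForm α * (twist α l ^ (k - 1)) p) +
        k.choose 2 • (2 * C (α ⬝ᵥ α) * (twist α l ^ (k - 2)) p) := by
  have hL := twist_mul_mulLeft α l (∑ i, X i ^ 2)
  rw [dirDerivation_sum_X_sq] at hL
  have hD := twist_mul_mulLeft α l (2 * linForm α)
  rw [show dirDerivation α (2 * linForm α) = 2 * C (α ⬝ᵥ α) by
    rw [two_mul, map_add, dirDerivation_linForm, two_mul]] at hD
  have hE := twist_mul_mulLeft α l (2 * C (α ⬝ᵥ α))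
  rw [show dirDerivation α (2 * C (α ⬝ᵥ α)) = 0 by
    rw [two_mul, map_add, derivation_C, add_zero], LinearMap.mulLeft_zero_eq_zero, add_zero] at hE
  simpa [mul_assoc] using LinearMap.congr_fun (pow_mul_of_commutators hL hD hE k) p

theorem linForm_pow_dvd {α : Fin n → ℝ} (hα : α ≠ 0) (m : ℕ) : ∀ g : MvPolynomial (Fin n) ℂ,
    (∀ j < m, ∀ y : Fin n → ℝ, y ⬝ᵥ α = 0 →
      eval (toComplex y) ((dirDerivation (toComplex α))^[j] g) = 0) →
    linForm (toComplex α) ^ m ∣ g := by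
  induction m with
  | zero => simp
  | succ m ih =>
    intro g hg
    obtain ⟨h, rfl⟩ := linForm_dvd_of_eval_eq_zero hα (hg 0 m.succ_pos)
    rw [pow_succ']
    refine mul_dvd_mul_left _ (ih h fun j hj y hy => ?_)
    have hiter : ∀ k q, (dirDerivation (toComplex α))^[k] q = (twist (toComplex α) 0 ^ k) q := by
      intro k q
      simp only [twist, zero_dotProduct, zero_smul, add_zero, Module.End.pow_apply]
      rfl
    have hderiv := hg (j + 1) (by omega) y hy
    rw [hiter, twist_pow_linForm_mul, map_add, map_mul, eval_linForm, toComplex_dotProduct, hy,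
      Complex.ofReal_zero, zero_mul, zero_add, map_nsmul, map_mul, eval_C, toComplex_dotProduct,
      Nat.add_sub_cancel, ← hiter, smul_eq_zero, mul_eq_zero, Complex.ofReal_eq_zero] at hderiv
    exact (hderiv.resolve_left j.succ_ne_zero).resolve_left (dotProduct_self_ne_zero hα)

end Twist

section BinomialTransform

variable {K : Type*} [Field K] [CharZero K] {m : ℕ} {b : ℕ → K}

theorem exists_polynomial_eval_eq_sum_choose (hb : ∀ k, m ≤ k → b k = 0) :
    ∃ B : Polynomial K, B.degree < m ∧
      ∀ N : ℕ, B.eval (N : K) = ∑ k ∈ Finset.range (N + 1), (N.choose k : K) * b k := by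
  refine ⟨∑ k ∈ Finset.range m, Polynomial.C (b k / (k.factorial : K)) * descPochhammer K k,
    ?_, fun N => ?_⟩
  · rw [← Polynomial.mem_degreeLT]
    refine Submodule.sum_mem _ fun k hk => ?_
    rw [← Polynomial.smul_eq_C_mul]
    refine Submodule.smul_mem _ _ (Polynomial.mem_degreeLT.2 ?_)
    refine Polynomial.degree_le_natDegree.trans_lt ?_
    rw [descPochhammer_natDegree]
    exact_mod_cast Finset.mem_range.1 hk
  · have hterm : ∀ k, (Polynomial.C (b k / (k.factorial : K)) * descPochhammer K k).eval (N : K) =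
        (N.choose k : K) * b k := by
      intro k
      have hk : (k.factorial : K) ≠ 0 := Nat.cast_ne_zero.2 k.factorial_ne_zero
      rw [Polynomial.eval_mul, Polynomial.eval_C, descPochhammer_eval_eq_descFactorial,
        Nat.descFactorial_eq_factorial_mul_choose]
      push_cast
      field_simp
    simp only [Polynomial.eval_finsetSum, hterm]
    rw [Finset.sum_subset (Finset.range_mono (le_max_left m (N + 1))) fun k _ hk => by
        rw [hb k (not_lt.1 (mt Finset.mem_range.2 hk)), mul_zero],
      Finset.sum_subset (Finset.range_mono (le_max_right m (N + 1))) fun k _ hk => by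
        rw [Nat.choose_eq_zero_of_lt (not_lt.1 (mt Finset.mem_range.2 hk)), Nat.cast_zero,
          zero_mul]]

theorem eq_zero_of_sum_choose_odd_eq_zero (hb : ∀ k, m ≤ k → b k = 0)
    (h : ∀ s < m, ∑ k ∈ Finset.range (2 * s + 1 + 1), ((2 * s + 1).choose k : K) * b k = 0)
    (k : ℕ) : b k = 0 := by
  obtain ⟨B, hdeg, heval⟩ := exists_polynomial_eval_eq_sum_choose hb
  have hB : B = 0 := by
    refine Polynomial.eq_zero_of_degree_lt_of_eval_index_eq_zero (Finset.range m)
      (v := fun s => ((2 * s + 1 : ℕ) : K)) (fun s _ t _ hst => ?_) (by rwa [Finset.card_range])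
      fun s hs => ?_
    · have := Nat.cast_injective (R := K) hst
      omega
    · rw [heval, h s (Finset.mem_range.1 hs)]
  induction k using Nat.strong_induction_on with
  | _ k ih =>
    have hk := heval k
    rwa [hB, Polynomial.eval_zero, Finset.sum_range_succ, Finset.sum_eq_zero fun j hj => by
      rw [ih j (Finset.mem_range.1 hj), mul_zero], zero_add, Nat.choose_self, Nat.cast_one, one_mul,
      eq_comm] at hk

end BinomialTransform

section QuasiInvariants

variable {R : Type*} [CommRing R] [Algebra ℝ R] {n : ℕ} {A : Configuration n} {l : Fin n → R}
  {p : MvPolynomial (Fin n) R}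

variable (A l) in
/-- The polynomials `p` such that `p(x) exp (x, l)` satisfies the vanishing conditions of a
Baker-Akhiezer function, over an arbitrary ring of coefficients so that `l` may be generic. -/
def quasiInvariants : Submodule R (MvPolynomial (Fin n) R) :=
  ⨅ (α ∈ A.vectors) (s : Fin (A.mult α)) (y : {y : Fin n → ℝ // y ⬝ᵥ α = 0}),
    LinearMap.ker ((aeval (algebraMap ℝ R ∘ y.1)).toLinearMap ∘ₗ
      twist (algebraMap ℝ R ∘ α) l ^ (2 * s.1 + 1))

theorem mem_quasiInvariants : p ∈ quasiInvariants A l ↔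
    ∀ α ∈ A.vectors, ∀ s < A.mult α, ∀ y : Fin n → ℝ, y ⬝ᵥ α = 0 →
      eval (algebraMap ℝ R ∘ y) ((twist (algebraMap ℝ R ∘ α) l ^ (2 * s + 1)) p) = 0 := by
  simp only [quasiInvariants, Submodule.mem_iInf, Subtype.forall, Fin.forall_iff, LinearMap.mem_ker]
  rfl

theorem sum_X_sq_mul_mem_quasiInvariants (hp : p ∈ quasiInvariants A l) :
    (∑ i, X i ^ 2) * p ∈ quasiInvariants A l := by
  rw [mem_quasiInvariants] at hp ⊢
  intro α hα s hs y hy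
  have hlow : (2 * s + 1).choose 2 • eval (algebraMap ℝ R ∘ y)
      ((twist (algebraMap ℝ R ∘ α) l ^ (2 * s + 1 - 2)) p) = 0 := by
    rcases s with _ | s
    · simp
    · rw [show 2 * (s + 1) + 1 - 2 = 2 * s + 1 by omega, hp α hα s (by omega) y hy, smul_zero]
  rw [twist_pow_sum_X_sq_mul, map_add, map_add, map_mul, hp α hα s hs y hy, map_nsmul, map_mul,
    map_mul, eval_linForm, ← RingHom.map_dotProduct, hy, map_nsmul, map_mul,
    ← mul_smul_comm ((2 * s + 1).choose 2), hlow]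
  simp only [map_zero, mul_zero, zero_mul, smul_zero, add_zero]

end QuasiInvariants

section TopComponent

variable {n : ℕ} {A : Configuration n} {l : Fin n → ℂ} {p q : MvPolynomial (Fin n) ℂ}

theorem sum_eval_iterate_dirDerivation_eq_zero (hp : p ∈ quasiInvariants A l) {α : Fin n → ℝ}
    (hα : α ∈ A.vectors) {s : ℕ} (hs : s < A.mult α) {y : Fin n → ℝ} (hy : y ⬝ᵥ α = 0) (r : ℕ) :
    ∑ k ∈ Finset.range (2 * s + 1 + 1), (l ⬝ᵥ toComplex α) ^ (2 * s + 1 - k) *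
      ((2 * s + 1).choose k : ℂ) * eval (toComplex y)
        ((dirDerivation (toComplex α))^[k] (homogeneousComponent (r + k) p)) = 0 := by
  have hcomp : eval (toComplex y)
      (homogeneousComponent r ((twist (toComplex α) l ^ (2 * s + 1)) p)) =
        eval (toComplex y) (homogeneousComponent r 0) :=
    eval_homogeneousComponent_eq_of_forall_smul (fun t _ => by
      rw [← toComplex_smul, map_zero]
      exact mem_quasiInvariants.1 hp α hα s hs (t • y) (by rw [smul_dotProduct, hy, smul_zero])) r
  rw [map_zero, map_zero, twist_pow_apply, map_sum, map_sum] at hcomp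
  simpa only [map_smul, smul_eval, homogeneousComponent_iterate_dirDerivation] using hcomp

theorem linForm_pow_dvd_homogeneousComponent (hp : p ∈ quasiInvariants A l) {α : Fin n → ℝ}
    (hα : α ∈ A.vectors) (hl : l ⬝ᵥ toComplex α ≠ 0) {d : ℕ} (hd : p.totalDegree ≤ d) :
    linForm (toComplex α) ^ A.mult α ∣ homogeneousComponent d p := by
  refine linForm_pow_dvd (A.ne_zero α hα) _ _ fun j hj y hy => ?_
  set c := l ⬝ᵥ toComplex α
  rcases lt_or_ge d j with hdj | hjd
  · rw [iterate_dirDerivation_eq_zero _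
      ((homogeneousComponent_isHomogeneous d p).totalDegree_le.trans_lt hdj), map_zero]
  obtain ⟨r, rfl⟩ := Nat.exists_eq_add_of_le' hjd
  let a : ℕ → ℂ := fun k => eval (toComplex y)
    ((dirDerivation (toComplex α))^[k] (homogeneousComponent (r + k) p))
  have ha : ∀ k, A.mult α ≤ k → a k * (c ^ k)⁻¹ = 0 := by
    intro k hk
    simp only [a]
    rw [homogeneousComponent_eq_zero _ _ (by omega), iterate_map_zero, map_zero, zero_mul]
  have hodd : ∀ s < A.mult α, ∑ k ∈ Finset.range (2 * s + 1 + 1),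
      ((2 * s + 1).choose k : ℂ) * (a k * (c ^ k)⁻¹) = 0 := by
    intro s hs
    refine (mul_eq_zero_iff_left (pow_ne_zero (2 * s + 1) hl)).1 ?_
    rw [Finset.mul_sum, ← sum_eval_iterate_dirDerivation_eq_zero hp hα hs hy r]
    refine Finset.sum_congr rfl fun k hk => ?_
    rw [pow_sub₀ _ hl (Finset.mem_range_succ_iff.1 hk)]
    ring
  exact (mul_eq_zero.1 (eq_zero_of_sum_choose_odd_eq_zero ha hodd j)).resolve_right
    (inv_ne_zero (pow_ne_zero _ hl))

theorem isHomogeneous_AmPoly (A : Configuration n) : A.AmPoly.IsHomogeneous A.totalMult :=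
  IsHomogeneous.prod _ _ _ fun α _ => by
    have hpow := (isHomogeneous_linForm (toComplex α)).pow (A.mult α)
    rwa [one_mul] at hpow

theorem AmPoly_ne_zero (A : Configuration n) : A.AmPoly ≠ 0 :=
  Finset.prod_ne_zero_iff.2 fun α hα => pow_ne_zero _ (linForm_ne_zero (A.ne_zero α hα))

theorem totalDegree_AmPoly (A : Configuration n) : A.AmPoly.totalDegree = A.totalMult :=
  (isHomogeneous_AmPoly A).totalDegree (AmPoly_ne_zero A)

theorem AmPoly_dvd_homogeneousComponent (hp : p ∈ quasiInvariants A l) (hl : A.Am l ≠ 0) {d : ℕ}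
    (hd : p.totalDegree ≤ d) : A.AmPoly ∣ homogeneousComponent d p := by
  refine Finset.prod_dvd_of_isRelPrime (fun α hα β hβ hne => ?_) fun α hα => ?_
  · exact (isRelPrime_linForm (A.ne_zero α hα) (A.noncolinear α hα β hβ hne)).pow
  · rcases Nat.eq_zero_or_pos (A.mult α) with h0 | h0
    · rw [h0, pow_zero]
      exact one_dvd _
    · refine linForm_pow_dvd_homogeneousComponent hp hα (fun h => hl ?_) hd
      exact Finset.prod_eq_zero hα (by rw [h, zero_pow h0.ne'])

theorem exists_homogeneousComponent_eq_C_mul_AmPoly (hp : p ∈ quasiInvariants A l)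
    (hl : A.Am l ≠ 0) (hd : p.totalDegree ≤ A.totalMult) :
    ∃ κ : ℂ, homogeneousComponent A.totalMult p = C κ * A.AmPoly := by
  obtain ⟨q, hq⟩ := AmPoly_dvd_homogeneousComponent hp hl hd
  rcases eq_or_ne q 0 with rfl | hq0
  · exact ⟨0, by rw [hq, mul_zero, C_0, zero_mul]⟩
  have hdeg : (A.AmPoly * q).totalDegree = A.totalMult :=
    hq ▸ (homogeneousComponent_isHomogeneous _ _).totalDegree
      (hq ▸ mul_ne_zero (AmPoly_ne_zero A) hq0)
  rw [totalDegree_mul_of_isDomain (AmPoly_ne_zero A) hq0, totalDegree_AmPoly,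
    Nat.add_eq_left] at hdeg
  exact ⟨coeff 0 q, by rw [hq, mul_comm, ← totalDegree_eq_zero_iff_eq_C.1 hdeg]⟩

theorem eq_zero_of_homogeneousComponent_eq_zero (hp : p ∈ quasiInvariants A l) (hl : A.Am l ≠ 0)
    (hd : p.totalDegree ≤ A.totalMult) (htop : homogeneousComponent A.totalMult p = 0) :
    p = 0 := by
  by_contra h0
  have hcomp := homogeneousComponent_totalDegree_ne_zero h0
  have hlt : p.totalDegree < A.totalMult :=
    hd.lt_of_ne fun h => hcomp (by rw [h, htop])
  have hle := totalDegree_le_of_dvd_of_isDomain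
    (AmPoly_dvd_homogeneousComponent hp hl le_rfl) hcomp
  rw [totalDegree_AmPoly, (homogeneousComponent_isHomogeneous _ _).totalDegree hcomp] at hle
  omega

theorem exists_eq_smul_of_homogeneousComponent_ne_zero (hp : p ∈ quasiInvariants A l)
    (hq : q ∈ quasiInvariants A l) (hl : A.Am l ≠ 0) (hpd : p.totalDegree ≤ A.totalMult)
    (hqd : q.totalDegree ≤ A.totalMult) (hq0 : homogeneousComponent A.totalMult q ≠ 0) :
    ∃ κ : ℂ, p = κ • q := by
  obtain ⟨a, ha⟩ := exists_homogeneousComponent_eq_C_mul_AmPoly hp hl hpd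
  obtain ⟨b, hb⟩ := exists_homogeneousComponent_eq_C_mul_AmPoly hq hl hqd
  have hb0 : b ≠ 0 := fun h => hq0 (by rw [hb, h, C_0, zero_mul])
  refine ⟨a / b, sub_eq_zero.1 (eq_zero_of_homogeneousComponent_eq_zero
    (sub_mem hp (Submodule.smul_mem _ _ hq)) hl ?_ ?_)⟩
  · exact (totalDegree_sub _ _).trans (max_le hpd ((totalDegree_smul_le _ _).trans hqd))
  · rw [map_sub, map_smul, ha, hb, smul_eq_C_mul, ← mul_assoc, ← C_mul, div_mul_cancel₀ _ hb0,
      sub_self]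

end TopComponent

section CoefficientDerivation

variable {k R σ : Type*} [CommRing k] [CommRing R] [Algebra k R]

/-- The action of a derivation of the coefficient ring on the coefficients of a polynomial. -/
def coeffDerivation (D : Derivation k R R) :
    Derivation k (MvPolynomial σ R) (MvPolynomial σ R) :=
  Derivation.mk'
    { toFun := AddMonoidAlgebra.map (D : R →+ R)
      map_add' := AddMonoidAlgebra.map_add _
      map_smul' := fun c p => MvPolynomial.ext _ _ fun a => D.map_smul c (coeff a p) }
    fun p q => by
      classical
      ext a
      change D (coeff a (p * q)) = _
      simp only [smul_eq_mul, coeff_add, mul_comm q, coeff_mul, map_sum, Derivation.leibniz]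
      rw [← Finset.sum_add_distrib]
      refine Finset.sum_congr rfl fun b _ => ?_
      rw [add_comm, mul_comm (coeff b.2 q)]
      exact add_comm _ _

theorem coeff_coeffDerivation (D : Derivation k R R) (a : σ →₀ ℕ) (p : MvPolynomial σ R) :
    coeff a (coeffDerivation D p) = D (coeff a p) := rfl

theorem coeffDerivation_C (D : Derivation k R R) (r : R) :
    coeffDerivation D (C r : MvPolynomial σ R) = C (D r) := by
  classical
  ext a
  rw [coeff_coeffDerivation, coeff_C, coeff_C, apply_ite D, map_zero]

theorem coeffDerivation_X (D : Derivation k R R) (i : σ) :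
    coeffDerivation D (X i : MvPolynomial σ R) = 0 := by
  classical
  ext a
  rw [coeff_coeffDerivation, coeff_X, coeff_zero, apply_ite D, map_zero, D.map_one_eq_zero,
    ite_self]

theorem coeffDerivation_map_algebraMap (D : Derivation k R R) (p : MvPolynomial σ k) :
    coeffDerivation D (map (algebraMap k R) p) = 0 := by
  ext a
  rw [coeff_coeffDerivation, coeff_map, D.map_algebraMap, coeff_zero]

theorem coeffDerivation_pderiv (D : Derivation k R R) (i : σ) (p : MvPolynomial σ R) :
    coeffDerivation D (pderiv i p) = pderiv i (coeffDerivation D p) := by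
  ext a
  rw [coeff_coeffDerivation, coeff_pderiv, coeff_pderiv, D.leibniz, map_add, D.map_natCast,
    D.map_one_eq_zero, add_zero, smul_zero, zero_add, smul_eq_mul, mul_comm, coeff_coeffDerivation]

theorem coeffDerivation_dirDerivation {n : ℕ} (D : Derivation k R R) {α : Fin n → R}
    (hα : ∀ i, D (α i) = 0) (p : MvPolynomial (Fin n) R) :
    coeffDerivation D (dirDerivation α p) = dirDerivation α (coeffDerivation D p) := by
  simp only [dirDerivation_apply, map_sum, Derivation.leibniz, coeffDerivation_C, hα, C_0,
    smul_eq_mul, mul_zero, add_zero, coeffDerivation_pderiv]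

theorem homogeneousComponent_coeffDerivation (D : Derivation k R R) (d : ℕ)
    (p : MvPolynomial σ R) :
    homogeneousComponent d (coeffDerivation D p) =
      coeffDerivation D (homogeneousComponent d p) := by
  ext a
  rw [coeff_coeffDerivation, coeff_homogeneousComponent, coeff_homogeneousComponent,
    coeff_coeffDerivation, apply_ite D, map_zero]

theorem totalDegree_coeffDerivation_le (D : Derivation k R R) (p : MvPolynomial σ R) :
    (coeffDerivation D p).totalDegree ≤ p.totalDegree :=
  Finset.sup_mono fun a ha => mem_support_iff.2 fun h => mem_support_iff.1 ha (by
    rw [coeff_coeffDerivation, h, map_zero])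

theorem eval_coeffDerivation (D : Derivation k R R) {x : σ → R} (hx : ∀ i, D (x i) = 0)
    (p : MvPolynomial σ R) : eval x (coeffDerivation D p) = D (eval x p) := by
  induction p using MvPolynomial.induction_on with
  | C r => rw [coeffDerivation_C, eval_C, eval_C]
  | add p q hp hq => simp only [map_add, hp, hq]
  | mul_X p i hp =>
    simp only [Derivation.leibniz, coeffDerivation_X, zero_add, map_mul, eval_X,
      smul_eq_mul, hp, hx, mul_zero]

end CoefficientDerivation

section SpectralOperator

/-- The operator `∂ᵢ + xᵢ`, that is, `∂ᵢ` conjugated by the exponential: the `i`-th partial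
derivative of `p(λ) exp (x, λ)` is `expPderiv x i p (λ) exp (x, λ)`. -/
def expPderiv {σ R : Type*} [CommSemiring R] (x : σ → R) (i : σ) (p : MvPolynomial σ R) :
    MvPolynomial σ R :=
  pderiv i p + C (x i) * p

variable {n : ℕ} {A : Configuration n} {F : MvPolynomial (Fin n) (MvPolynomial (Fin n) ℂ)}

/-- The operator `expPderiv` in the variable `λ`, on polynomials in `x` whose coefficients are
polynomials in `λ`. -/
def spectralDeriv (i : Fin n) (F : MvPolynomial (Fin n) (MvPolynomial (Fin n) ℂ)) :
    MvPolynomial (Fin n) (MvPolynomial (Fin n) ℂ) :=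
  coeffDerivation (pderiv i) F + X i * F

theorem twist_spectralDeriv (i : Fin n) (c : Fin n → ℂ)
    (F : MvPolynomial (Fin n) (MvPolynomial (Fin n) ℂ)) :
    twist (C ∘ c) X (spectralDeriv i F) = spectralDeriv i (twist (C ∘ c) X F) := by
  have hconst : ∀ j, pderiv i ((C ∘ c : Fin n → MvPolynomial (Fin n) ℂ) j) = 0 :=
    fun j => pderiv_C
  have hpair : pderiv i ((X : Fin n → MvPolynomial (Fin n) ℂ) ⬝ᵥ C ∘ c) = C (c i) := by
    classical
    simp [dotProduct, pderiv_X, Pi.single_apply]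
  simp only [spectralDeriv, twist_apply, map_add, Derivation.leibniz, dirDerivation_X,
    coeffDerivation_dirDerivation _ hconst, smul_eq_C_mul, coeffDerivation_C, hpair, smul_eq_mul,
    Function.comp_apply]
  ring

theorem twist_pow_spectralDeriv (i : Fin n) (c : Fin n → ℂ) (k : ℕ) :
    (twist (C ∘ c) X ^ k) (spectralDeriv i F) = spectralDeriv i ((twist (C ∘ c) X ^ k) F) := by
  induction k with
  | zero => rfl
  | succ k ih => rw [pow_succ', Module.End.mul_apply, Module.End.mul_apply, ih, twist_spectralDeriv]

theorem eval_spectralDeriv (i : Fin n) (x : Fin n → ℂ) :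
    eval (C ∘ x) (spectralDeriv i F) = expPderiv x i (eval (C ∘ x) F) := by
  rw [spectralDeriv, expPderiv, map_add, map_mul, eval_X,
    eval_coeffDerivation (x := C ∘ x) _ (fun _ => pderiv_C), Function.comp_apply]

theorem spectralDeriv_mem_quasiInvariants (i : Fin n) (hF : F ∈ quasiInvariants A X) :
    spectralDeriv i F ∈ quasiInvariants A X := by
  rw [mem_quasiInvariants] at hF ⊢
  intro α hα s hs y hy
  have hvanish : eval (C ∘ toComplex y) ((twist (C ∘ toComplex α) X ^ (2 * s + 1)) F) = 0 :=
    hF α hα s hs y hy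
  change eval (C ∘ toComplex y) ((twist (C ∘ toComplex α) X ^ (2 * s + 1)) _) = 0
  rw [twist_pow_spectralDeriv, eval_spectralDeriv, hvanish, expPderiv, map_zero, mul_zero, add_zero]

variable (A F) in
/-- The Calogero-Moser operator `∑ᵢ ∂ᵢ² - ∑ᵢ 2 (∂ᵢ A_m / A_m) ∂ᵢ - x²` in the spectral variable `λ`,
conjugated by `exp (x, λ)` and cleared of its denominator `A_m(λ)`. -/
def spectralOperator : MvPolynomial (Fin n) (MvPolynomial (Fin n) ℂ) :=
  C A.AmPoly * (∑ i, spectralDeriv i (spectralDeriv i F) - (∑ i, X i ^ 2) * F) -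
    2 * ∑ i, C (pderiv i A.AmPoly) * spectralDeriv i F

theorem spectralOperator_mem_quasiInvariants (hF : F ∈ quasiInvariants A X) :
    spectralOperator A F ∈ quasiInvariants A X := by
  have hderiv := fun i => spectralDeriv_mem_quasiInvariants i hF
  simp only [spectralOperator, two_mul, ← smul_eq_C_mul]
  exact sub_mem (Submodule.smul_mem _ _ (sub_mem (Submodule.sum_mem _ fun i _ =>
      spectralDeriv_mem_quasiInvariants i (hderiv i)) (sum_X_sq_mul_mem_quasiInvariants hF)))
    (add_mem (Submodule.sum_mem _ fun i _ => Submodule.smul_mem _ _ (hderiv i))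
      (Submodule.sum_mem _ fun i _ => Submodule.smul_mem _ _ (hderiv i)))

end SpectralOperator

section SpectralEquation

variable {n : ℕ} {A : Configuration n} {F : MvPolynomial (Fin n) (MvPolynomial (Fin n) ℂ)}

/-- The defect of the eigenvalue equation `(∑ᵢ ∂ᵢ² - ∑ᵢ 2 (∂ᵢ A_m / A_m) ∂ᵢ) f = x² f` for the
function `f(λ) = q(λ) exp (x, λ)`, multiplied by `A_m(λ)` and divided by the exponential. -/
def spectralDefect (A : Configuration n) (x : Fin n → ℂ) (q : MvPolynomial (Fin n) ℂ) :
    MvPolynomial (Fin n) ℂ :=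
  A.AmPoly * (∑ i, expPderiv x i (expPderiv x i q) - C (x ⬝ᵥ x) * q) -
    2 * ∑ i, pderiv i A.AmPoly * expPderiv x i q

theorem eval_spectralOperator (x : Fin n → ℂ) :
    eval (C ∘ x) (spectralOperator A F) = spectralDefect A x (eval (C ∘ x) F) := by
  simp only [spectralOperator, spectralDefect, map_sub, map_mul, map_sum, map_ofNat, eval_X,
    eval_C, eval_spectralDeriv, dotProduct, sq, Function.comp_apply]

theorem spectralDefect_zero_C (c : ℂ) : spectralDefect A 0 (C c) = 0 := by
  simp [spectralDefect, expPderiv]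

theorem eval_zero_spectralOperator {c : ℂ} (hF : eval (C ∘ (0 : Fin n → ℂ)) F = C c) :
    eval (C ∘ (0 : Fin n → ℂ)) (spectralOperator A F) = 0 := by
  rw [eval_spectralOperator, hF, spectralDefect_zero_C]

theorem spectralOperator_eq : spectralOperator A F =
    C A.AmPoly * ∑ i, coeffDerivation (pderiv i) (coeffDerivation (pderiv i) F) -
      2 * ∑ i, C (pderiv i A.AmPoly) * coeffDerivation (pderiv i) F +
      2 * ∑ i, X i * (C A.AmPoly * coeffDerivation (pderiv i) F - C (pderiv i A.AmPoly) * F) := by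
  simp only [spectralOperator, spectralDeriv, map_add, Derivation.leibniz, coeffDerivation_X,
    smul_eq_mul, mul_zero, add_zero, Finset.sum_mul, Finset.mul_sum, ← Finset.sum_sub_distrib,
    ← Finset.sum_add_distrib]
  refine Finset.sum_congr rfl fun i _ => ?_
  ring

theorem homogeneousComponent_C_mul_coeffDerivation_sub_eq_zero (i : Fin n)
    (htop : homogeneousComponent A.totalMult F = C A.AmPoly * map C A.AmPoly) :
    homogeneousComponent A.totalMult
      (C A.AmPoly * coeffDerivation (pderiv i) F - C (pderiv i A.AmPoly) * F) = 0 := by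
  rw [map_sub, homogeneousComponent_C_mul, homogeneousComponent_C_mul,
    homogeneousComponent_coeffDerivation, htop, Derivation.leibniz, coeffDerivation_C,
    show coeffDerivation (pderiv i) (map C A.AmPoly) = 0 from coeffDerivation_map_algebraMap _ _,
    smul_zero, zero_add, smul_eq_mul]
  ring

theorem totalDegree_spectralOperator_le (hd : F.totalDegree ≤ A.totalMult)
    (htop : homogeneousComponent A.totalMult F = C A.AmPoly * map C A.AmPoly) :
    (spectralOperator A F).totalDegree ≤ A.totalMult := by
  have hC_mul : ∀ (q : MvPolynomial (Fin n) ℂ) {G : MvPolynomial (Fin n) (MvPolynomial (Fin n) ℂ)},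
      G.totalDegree ≤ A.totalMult → C q * G ∈ restrictTotalDegree (Fin n) _ A.totalMult :=
    fun q G hG => smul_eq_C_mul G q ▸ Submodule.smul_mem _ q ((mem_restrictTotalDegree _ _ _).2 hG)
  have hderiv : ∀ (i : Fin n) {G : MvPolynomial (Fin n) (MvPolynomial (Fin n) ℂ)},
      G.totalDegree ≤ A.totalMult → (coeffDerivation (pderiv i) G).totalDegree ≤ A.totalMult :=
    fun i G hG => (totalDegree_coeffDerivation_le _ _).trans hG
  rw [spectralOperator_eq, ← mem_restrictTotalDegree, Finset.mul_sum, two_mul, two_mul]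
  have hfirst := Submodule.sum_mem (restrictTotalDegree (Fin n) _ A.totalMult)
    (t := Finset.univ) fun i _ => hC_mul (pderiv i A.AmPoly) (hderiv i hd)
  have hlast := Submodule.sum_mem (restrictTotalDegree (Fin n) _ A.totalMult)
    (t := Finset.univ) fun i _ => (mem_restrictTotalDegree _ _ _).2
      (totalDegree_X_mul_le_of_homogeneousComponent_eq_zero
        ((mem_restrictTotalDegree _ _ _).1 (sub_mem (hC_mul A.AmPoly (hderiv i hd))
          (hC_mul (pderiv i A.AmPoly) hd)))
        (homogeneousComponent_C_mul_coeffDerivation_sub_eq_zero i htop) i)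
  exact add_mem (sub_mem (Submodule.sum_mem _ fun i _ => hC_mul _ (hderiv i (hderiv i hd)))
    (add_mem hfirst hfirst)) (add_mem hlast hlast)

end SpectralEquation

section PolynomialFamilies

variable {σ τ : Type*}

/-- The zero set of a nonzero polynomial meets a suitable line in finitely many points, so its
complement is dense along that line. -/
theorem eq_of_eq_of_eval_ne_zero {D : MvPolynomial σ ℂ} (hD : D ≠ 0) {f g : (σ → ℂ) → ℂ}
    (hf : Continuous f) (hg : Continuous g) (h : ∀ l, eval l D ≠ 0 → f l = g l) (l : σ → ℂ) :
    f l = g l := by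
  obtain ⟨μ, hμ⟩ : ∃ μ, eval μ D ≠ 0 := by
    by_contra! hzero
    exact hD (funext fun x => by rw [hzero x, map_zero])
  let line : ℂ → σ → ℂ := fun s => l + s • (μ - l)
  have hline : Continuous line := by fun_prop
  let u : Polynomial ℂ :=
    aeval (fun i => Polynomial.C (l i) + Polynomial.X * Polynomial.C (μ i - l i)) D
  have hu : ∀ s, u.eval s = eval (line s) D := by
    intro s
    have hcomp : (Polynomial.aeval s : Polynomial ℂ →ₐ[ℂ] ℂ).comp
        (aeval fun i => Polynomial.C (l i) + Polynomial.X * Polynomial.C (μ i - l i)) =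
        aeval (line s) := by
      ext i
      simp [line]
    exact DFunLike.congr_fun hcomp D
  have hu0 : u ≠ 0 := by
    intro h0
    have hu1 := hu 1
    rw [h0] at hu1
    exact hμ (by simpa [line] using hu1.symm)
  have hdense : Dense {s : ℂ | u.eval s = 0}ᶜ :=
    (Polynomial.finite_setOfPred_isRoot hu0).countable.dense_compl ℝ
  have hext := Continuous.ext_on hdense (hf.comp hline) (hg.comp hline) fun s hs =>
    h _ (by rwa [← hu])
  simpa [line] using congrFun hext 0

theorem eq_of_map_eval_eq {F G : MvPolynomial τ (MvPolynomial σ ℂ)}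
    (h : ∀ l, map (eval l) F = map (eval l) G) : F = G := by
  ext1 a
  refine funext fun l => ?_
  rw [← coeff_map, h, coeff_map]

theorem dvd_of_prime_of_eval [Finite σ] {π Q : MvPolynomial σ ℂ} (hπ : Prime π)
    (h : ∀ l, eval l π = 0 → eval l Q = 0) : π ∣ Q := by
  have hprime : (Ideal.span {π}).IsPrime := (Ideal.span_singleton_prime hπ.ne_zero).2 hπ
  rw [← Ideal.mem_span_singleton, ← IsPrime.vanishingIdeal_zeroLocus (K := ℂ) (Ideal.span {π})]
  intro l hl
  have hπl := hl π (Ideal.mem_span_singleton_self π)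
  rw [aeval_eq_eval] at hπl ⊢
  exact h l hπl

theorem exists_eval_eq_of_continuous [Finite σ] {D : MvPolynomial σ ℂ} : D ≠ 0 →
    ∀ f : (σ → ℂ) → ℂ, Continuous f →
    (∃ Q : MvPolynomial σ ℂ, ∀ l, eval l D * f l = eval l Q) →
    ∃ R : MvPolynomial σ ℂ, ∀ l, f l = eval l R := by
  induction D using UniqueFactorizationMonoid.induction_on_prime with
  | h₁ => exact fun h => absurd rfl h
  | h₂ D hD =>
    rintro - f - ⟨Q, hQ⟩
    obtain ⟨E, hE⟩ := hD.exists_left_inv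
    refine ⟨E * Q, fun l => ?_⟩
    rw [map_mul, ← hQ, ← mul_assoc, ← map_mul, hE, map_one, one_mul]
  | h₃ D π hD hπ ih =>
    rintro - f hf ⟨Q, hQ⟩
    obtain ⟨R, rfl⟩ := dvd_of_prime_of_eval (Q := Q) hπ fun l hl => by
      rw [← hQ, map_mul, hl, zero_mul, zero_mul]
    refine ih hD f hf ⟨R, eq_of_eq_of_eval_ne_zero hπ.ne_zero
      ((MvPolynomial.continuous_eval D).mul hf) (MvPolynomial.continuous_eval R) fun l hl => ?_⟩
    have hQl := hQ l
    rw [map_mul, map_mul, mul_assoc] at hQl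
    exact mul_left_cancel₀ hl hQl

theorem exists_isUnit_det {K V ι E : Type*} [Field K] [AddCommGroup V] [Module K V] [Fintype ι]
    [DecidableEq ι] (b : Module.Basis ι K V) {w : E → Module.Dual K V}
    (h : ∀ v, (∀ e, w e v = 0) → v = 0) :
    ∃ e : ι → E, IsUnit (Matrix.of fun j i => w (e j) (b i)).det := by
  have := Module.Finite.of_basis b
  obtain ⟨κ, a, -, hspan, hindep⟩ := exists_linearIndependent' K w
  have htop : ⊤ ≤ Submodule.span K (Set.range (w ∘ a)) := by
    rintro f -
    rw [hspan]
    refine FiniteDimensional.mem_span_of_iInf_ker_le_ker fun v hv => ?_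
    rw [Submodule.mem_iInf] at hv
    rw [h v fun e => LinearMap.mem_ker.1 (hv e)]
    exact zero_mem _
  let c := Module.Basis.mk hindep htop
  let c' := c.reindex (c.indexEquiv b.dualBasis)
  refine ⟨a ∘ (c.indexEquiv b.dualBasis).symm, ?_⟩
  have hdet : Matrix.of (fun j i => w ((a ∘ (c.indexEquiv b.dualBasis).symm) j) (b i)) =
      (b.dualBasis.toMatrix c').transpose := by
    ext j i
    simp [c', c, Module.Basis.toMatrix_apply]
  rw [hdet, Matrix.det_transpose, ← Module.Basis.det_apply]
  exact b.dualBasis.isUnit_det c'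

theorem exists_denominator {V ι E : Type*} [AddCommGroup V] [Module ℂ V] [Fintype ι]
    (b : Module.Basis ι ℂ V) {r : E → ι → MvPolynomial σ ℂ} {c : E → MvPolynomial σ ℂ}
    {v : (σ → ℂ) → V} (hv : ∀ e l, ∑ i, eval l (r e i) * b.repr (v l) i = eval l (c e))
    {l₀ : σ → ℂ} (huniq : ∀ u, (∀ e, ∑ i, eval l₀ (r e i) * b.repr u i = 0) → u = 0) :
    ∃ D : MvPolynomial σ ℂ, D ≠ 0 ∧
      ∀ i, ∃ Q : MvPolynomial σ ℂ, ∀ l, eval l D * b.repr (v l) i = eval l Q := by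
  classical
  obtain ⟨e, he⟩ := exists_isUnit_det b (w := fun e => ∑ i, eval l₀ (r e i) • b.coord i)
    (by simpa using huniq)
  let M : Matrix ι ι (MvPolynomial σ ℂ) := Matrix.of fun j i => r (e j) i
  have hM : ∀ l, ((eval l).mapMatrix M).mulVec (b.repr (v l)) = eval l ∘ c ∘ e :=
    fun l => funext fun j => hv (e j) l
  refine ⟨M.det, fun h0 => he.ne_zero ?_, fun i => ⟨M.adjugate.mulVec (c ∘ e) i, fun l => ?_⟩⟩
  · have hdet := RingHom.map_det (eval l₀) M
    rw [h0, map_zero] at hdet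
    rw [hdet]
    congr 1
    ext j i
    simp [M, Finsupp.single_apply]
  · have hcramer := congrArg (fun u => ((eval l).mapMatrix M.adjugate).mulVec u i) (hM l)
    simp only [Matrix.mulVec_mulVec, ← map_mul, Matrix.adjugate_mul] at hcramer
    simpa [Matrix.mulVec, dotProduct, Matrix.one_apply, apply_ite (eval l)] using hcramer

theorem continuous_coeff {T : Type*} [TopologicalSpace T] [Finite τ] {d : ℕ}
    {P : T → MvPolynomial τ ℂ} (hdeg : ∀ t, (P t).totalDegree ≤ d)
    (hcont : ∀ x, Continuous fun t => eval x (P t)) (a : τ →₀ ℕ) :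
    Continuous fun t => coeff a (P t) := by
  let V := restrictTotalDegree τ ℂ d
  have hspan : lcoeff ℂ a ∘ₗ V.subtype ∈
      Submodule.span ℂ (Set.range fun x : τ → ℂ => (aeval x).toLinearMap ∘ₗ V.subtype) := by
    refine FiniteDimensional.mem_span_of_iInf_ker_le_ker fun p hp => ?_
    have hp0 : (p : MvPolynomial τ ℂ) = 0 := funext fun x => by
      simpa using (Submodule.mem_iInf _).1 hp x
    simp [hp0]
  have hcont_span : ∀ f ∈ Submodule.span ℂ
      (Set.range fun x : τ → ℂ => (aeval x).toLinearMap ∘ₗ V.subtype),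
      Continuous fun t => f ⟨P t, (mem_restrictTotalDegree _ _ _).2 (hdeg t)⟩ := by
    intro f hf
    induction hf using Submodule.span_induction with
    | mem f hf =>
      obtain ⟨x, rfl⟩ := hf
      exact hcont x
    | zero => exact continuous_const
    | add f g _ _ hf hg => exact hf.add hg
    | smul c f _ hf => exact hf.const_smul c
  exact hcont_span _ hspan

theorem sum_monomial_coeff {R : Type*} [CommSemiring R] {S : Set (τ →₀ ℕ)} [Fintype S]
    {p : MvPolynomial τ R} (hp : p ∈ restrictSupport R S) :
    ∑ a : S, monomial a.1 (coeff a.1 p) = p := by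
  classical
  ext c
  simp only [coeff_sum, coeff_monomial]
  by_cases hc : c ∈ S
  · rw [Finset.sum_eq_single ⟨c, hc⟩ (fun a _ ha => if_neg fun h => ha (Subtype.ext h)) (by simp),
      if_pos rfl]
  · rw [Finset.sum_eq_zero fun a _ => if_neg fun h : a.1 = c => hc (h ▸ a.2), eq_comm,
      ← notMem_support_iff]
    exact fun hcp => hc (hp hcp)

/-- The parameter-dependent linear equations are functionals `r e` on polynomials over the ring of
polynomials in the parameter. Cramer's rule at the parameter `l₀` makes the coefficients rational
functions, and continuity makes these polynomials. -/
theorem exists_map_eval_eq [Finite σ] [Finite τ] {E : Type*} {d : ℕ}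
    {P : (σ → ℂ) → MvPolynomial τ ℂ} (hdeg : ∀ l, (P l).totalDegree ≤ d)
    (hcont : ∀ x, Continuous fun l => eval x (P l))
    (r : E → MvPolynomial τ (MvPolynomial σ ℂ) →ₗ[MvPolynomial σ ℂ] MvPolynomial σ ℂ)
    {c : E → MvPolynomial σ ℂ} (hP : ∀ e l, eval l (r e (map C (P l))) = eval l (c e)) {l₀ : σ → ℂ}
    (huniq : ∀ p, p.totalDegree ≤ d → (∀ e, eval l₀ (r e (map C p)) = 0) → p = 0) :
    ∃ F : MvPolynomial τ (MvPolynomial σ ℂ), F.totalDegree ≤ d ∧ ∀ l, map (eval l) F = P l := by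
  let S : Set (τ →₀ ℕ) := {a : τ →₀ ℕ | (a.sum fun _ e => e) ≤ d}
  let b : Module.Basis S ℂ (restrictTotalDegree τ ℂ d) := basisRestrictSupport ℂ _
  have hmem : ∀ l, P l ∈ restrictTotalDegree τ ℂ d :=
    fun l => (mem_restrictTotalDegree _ _ _).2 (hdeg l)
  have := Module.Finite.finite_basis b
  have := Fintype.ofFinite S
  have hspec : ∀ e l, ∀ p ∈ restrictTotalDegree τ ℂ d,
      ∑ a : S, eval l (r e (monomial a.1 1)) * coeff a.1 p = eval l (r e (map C p)) := by
    intro e l p hp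
    conv_rhs => rw [← sum_monomial_coeff hp]
    simp only [map_sum, map_monomial]
    refine Finset.sum_congr rfl fun a _ => ?_
    rw [← mul_one (C (coeff a.1 p)), ← smul_eq_mul (C _), ← smul_monomial, map_smul, smul_eq_mul,
      map_mul, eval_C, mul_comm]
  obtain ⟨D, hD, hQ⟩ := exists_denominator b (v := fun l => ⟨P l, hmem l⟩)
    (r := fun e a => r e (monomial a.1 1))
    (fun e l => (hspec e l _ (hmem l)).trans (hP e l)) (l₀ := l₀) fun u hu =>
      Subtype.ext (huniq u ((mem_restrictTotalDegree _ _ _).1 u.2) fun e =>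
        (hspec e l₀ u u.2).symm.trans (hu e))
  choose R hR using fun a : S => exists_eval_eq_of_continuous hD _
    (continuous_coeff hdeg hcont a.1) (hQ a)
  refine ⟨∑ a, monomial a.1 (R a), totalDegree_finsetSum_le fun a _ => ?_, fun l => ?_⟩
  · exact (totalDegree_monomial_le _ _).trans a.2
  · simp only [map_sum, map_monomial, ← hR]
    exact sum_monomial_coeff (hmem l)

end PolynomialFamilies

section Differentiation

variable {n : ℕ}

theorem hasDerivAt_eval {𝕜 : Type*} [NontriviallyNormedField 𝕜] [NormedAlgebra 𝕜 ℂ]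
    {σ : Type*} [Fintype σ] (p : MvPolynomial σ ℂ) {c : 𝕜 → σ → ℂ} {c' : σ → ℂ} {t : 𝕜}
    (hc : ∀ i, HasDerivAt (fun s => c s i) (c' i) t) :
    HasDerivAt (fun s => eval (c s) p) (∑ i, c' i * eval (c t) (pderiv i p)) t := by
  classical
  induction p using MvPolynomial.induction_on with
  | C a => simpa using hasDerivAt_const t a
  | add p q hp hq =>
    simp only [map_add, mul_add, Finset.sum_add_distrib]
    exact hp.add hq
  | mul_X p j hp =>
    simp only [map_mul, eval_X]
    refine (hp.mul (hc j)).congr_deriv ?_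
    simp only [Derivation.leibniz, pderiv_X, Pi.single_apply, smul_eq_mul, map_add, map_mul, eval_X,
      mul_add, Finset.sum_add_distrib, Finset.sum_mul]
    rw [add_comm]
    congr 1
    · simp [mul_comm]
    · exact Finset.sum_congr rfl fun i _ => by ring

theorem hasDerivAt_eval_mul_exp {𝕜 : Type*} [NontriviallyNormedField 𝕜] [NormedAlgebra 𝕜 ℂ]
    {σ : Type*} [Fintype σ] (p : MvPolynomial σ ℂ) (l : σ → ℂ) {c : 𝕜 → σ → ℂ} {c' : σ → ℂ} {t : 𝕜}
    (hc : ∀ i, HasDerivAt (fun s => c s i) (c' i) t) :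
    HasDerivAt (fun s => eval (c s) p * Complex.exp (c s ⬝ᵥ l))
      ((∑ i, c' i * eval (c t) (expPderiv l i p)) * Complex.exp (c t ⬝ᵥ l)) t := by
  have hdot : HasDerivAt (fun s => c s ⬝ᵥ l) (∑ i, c' i * l i) t :=
    HasDerivAt.fun_sum fun i _ => (hc i).mul_const (l i)
  refine ((hasDerivAt_eval p hc).mul
    ((Complex.hasDerivAt_exp _).comp_of_eq t hdot rfl)).congr_deriv ?_
  simp only [expPderiv, map_add, map_mul, eval_C, mul_add, Finset.sum_add_distrib,
    ← mul_assoc (c' _) (l _), ← Finset.sum_mul, Function.comp_apply]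
  ring

theorem iteratedDeriv_eval_mul_exp (α l x : Fin n → ℂ) (k : ℕ) (p : MvPolynomial (Fin n) ℂ) :
    iteratedDeriv k (fun t : ℂ => eval (x + t • α) p * Complex.exp ((x + t • α) ⬝ᵥ l)) = fun t =>
      eval (x + t • α) ((twist α l ^ k) p) * Complex.exp ((x + t • α) ⬝ᵥ l) := by
  induction k with
  | zero => simp [iteratedDeriv_zero]
  | succ k ih =>
    rw [iteratedDeriv_succ, ih]
    funext t
    have hline : ∀ i, HasDerivAt (fun s : ℂ => (x + s • α) i) (α i) t := fun i => by
      simpa using ((hasDerivAt_id t).mul_const (α i)).const_add (x i)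
    rw [(hasDerivAt_eval_mul_exp ((twist α l ^ k) p) l hline).deriv, pow_succ',
      Module.End.mul_apply, twist_apply, dirDerivation_apply,
      show l ⬝ᵥ α = ∑ i, l i * α i from rfl, Finset.sum_smul, ← Finset.sum_add_distrib, map_sum]
    congr 1
    refine Finset.sum_congr rfl fun i _ => ?_
    rw [expPderiv, map_add, map_add, smul_eval, map_mul, map_mul, eval_C, eval_C]
    ring

theorem mem_quasiInvariants_iff_dirDeriv {A : Configuration n} {l : Fin n → ℂ}
    {p : MvPolynomial (Fin n) ℂ} : p ∈ quasiInvariants A l ↔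
      ∀ α ∈ A.vectors, ∀ s < A.mult α, ∀ y : Fin n → ℝ, y ⬝ᵥ α = 0 →
        dirDeriv α (2 * s + 1) (fun x => eval x p * Complex.exp (x ⬝ᵥ l)) (toComplex y) = 0 := by
  simp only [dirDeriv, iteratedDeriv_eval_mul_exp, zero_smul, add_zero, mul_eq_zero,
    Complex.exp_ne_zero, or_false]
  exact mem_quasiInvariants

end Differentiation

section PolynomialDependence

variable {n : ℕ} {A : Configuration n}

theorem eval_eval_C {σ τ : Type*} (l : σ → ℂ) (x : τ → ℂ) (F : MvPolynomial τ (MvPolynomial σ ℂ)) :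
    eval l (eval (C ∘ x) F) = eval x (map (eval l) F) := by
  rw [eval_map, ← coe_eval₂Hom, ← RingHom.comp_apply]
  congr 1
  ext <;> simp

theorem map_eval_map_C {σ τ : Type*} (l : σ → ℂ) (p : MvPolynomial τ ℂ) :
    map (eval l) (map C p) = p := by
  rw [MvPolynomial.map_map, show (eval l).comp C = .id ℂ from RingHom.ext eval_C,
    MvPolynomial.map_id]

theorem eval_twist_pow_X (α x l : Fin n → ℂ) (k : ℕ)
    (F : MvPolynomial (Fin n) (MvPolynomial (Fin n) ℂ)) :
    eval l (eval (C ∘ x) ((twist (C ∘ α) X ^ k) F)) =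
      eval x ((twist α l ^ k) (map (eval l) F)) := by
  have hα : eval l ∘ C ∘ α = α := funext fun i => eval_C _
  have hX : eval l ∘ X = l := funext fun i => eval_X _
  rw [eval_eval_C, map_twist_pow, hα, hX]

theorem mem_quasiInvariants_X {F : MvPolynomial (Fin n) (MvPolynomial (Fin n) ℂ)} :
    F ∈ quasiInvariants A X ↔ ∀ l, map (eval l) F ∈ quasiInvariants A l := by
  simp only [mem_quasiInvariants]
  refine ⟨fun h l α hα s hs y hy => ?_, fun h α hα s hs y hy => funext fun l => ?_⟩
  · exact (eval_twist_pow_X _ _ _ _ _).symm.trans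
      ((congrArg (eval l) (h α hα s hs y hy)).trans (map_zero _))
  · exact (eval_twist_pow_X _ _ _ _ _).trans ((h l α hα s hs y hy).trans (map_zero _).symm)

theorem exists_Am_ne_zero (A : Configuration n) : ∃ l, A.Am l ≠ 0 := by
  by_contra! h
  exact AmPoly_ne_zero A (funext fun l => by rw [A.eval_AmPoly, h l, map_zero])

theorem exists_map_eval_eq_of_mem_quasiInvariants {P : (Fin n → ℂ) → MvPolynomial (Fin n) ℂ}
    (hdeg : ∀ l, (P l).totalDegree ≤ A.totalMult)
    (htop : ∀ l, homogeneousComponent A.totalMult (P l) = C (A.Am l) * A.AmPoly)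
    (hP : ∀ l, P l ∈ quasiInvariants A l) (hcont : ∀ x, Continuous fun l => eval x (P l)) :
    ∃ F : MvPolynomial (Fin n) (MvPolynomial (Fin n) ℂ),
      F.totalDegree ≤ A.totalMult ∧ ∀ l, map (eval l) F = P l := by
  obtain ⟨l₀, hl₀⟩ := exists_Am_ne_zero A
  let E := {e : (Fin n → ℝ) × ℕ × (Fin n → ℝ) //
    e.1 ∈ A.vectors ∧ e.2.1 < A.mult e.1 ∧ e.2.2 ⬝ᵥ e.1 = 0} ⊕ (Fin n →₀ ℕ)
  let r : E → MvPolynomial (Fin n) (MvPolynomial (Fin n) ℂ) →ₗ[MvPolynomial (Fin n) ℂ]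
      MvPolynomial (Fin n) ℂ :=
    Sum.elim (fun e => (aeval (C ∘ toComplex e.1.2.2)).toLinearMap ∘ₗ
      twist (C ∘ toComplex e.1.1) X ^ (2 * e.1.2.1 + 1))
      (fun a => lcoeff _ a ∘ₗ homogeneousComponent A.totalMult)
  have hinl : ∀ e l p, eval l (r (.inl e) (map C p)) =
      eval (toComplex e.1.2.2) ((twist (toComplex e.1.1) l ^ (2 * e.1.2.1 + 1)) p) := by
    intro e l p
    exact (eval_twist_pow_X _ _ _ _ _).trans (by rw [map_eval_map_C])
  have hinr : ∀ a l p, eval l (r (.inr a) (map C p)) =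
      coeff a (homogeneousComponent A.totalMult p) := by
    intro a l p
    simp only [r, Sum.elim_inr, LinearMap.comp_apply, lcoeff_apply, coeff_homogeneousComponent,
      coeff_map]
    split_ifs <;> simp
  refine exists_map_eval_eq hdeg hcont r (c := Sum.elim 0 fun a => C (coeff a A.AmPoly) * A.AmPoly)
    ?_ (l₀ := l₀) fun p hp hpr => ?_
  · rintro (e | a) l
    · rw [hinl]
      exact (mem_quasiInvariants.1 (hP l) _ e.2.1 _ e.2.2.1 _ e.2.2.2).trans (map_zero _).symm
    · rw [hinr, htop, coeff_C_mul, Sum.elim_inr, map_mul, eval_C, A.eval_AmPoly, mul_comm]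
  · refine eq_zero_of_homogeneousComponent_eq_zero (mem_quasiInvariants.2 fun α hα s hs y hy => ?_)
      hl₀ hp (MvPolynomial.ext _ _ fun a => ?_)
    · exact (hinl ⟨(α, s, y), hα, hs, hy⟩ _ _).symm.trans (hpr _)
    · exact (hinr a _ _).symm.trans (hpr _)

end PolynomialDependence

section BakerAkhiezerPolynomials

variable {n : ℕ} {A : Configuration n} {F : MvPolynomial (Fin n) (MvPolynomial (Fin n) ℂ)}

/-- `F(x, λ)` is the polynomial part of a Baker-Akhiezer function `F(x, λ) exp (x, λ)`, encoded as a
polynomial in `x` whose coefficients are polynomials in `λ`. -/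
structure IsBakerAkhiezerPolynomial (A : Configuration n)
    (F : MvPolynomial (Fin n) (MvPolynomial (Fin n) ℂ)) : Prop where
  totalDegree_le : F.totalDegree ≤ A.totalMult
  homogeneousComponent_eq : homogeneousComponent A.totalMult F = C A.AmPoly * map C A.AmPoly
  mem_quasiInvariants : F ∈ quasiInvariants A X

theorem map_homogeneousComponent {R S σ : Type*} [CommSemiring R] [CommSemiring S] (f : R →+* S)
    (k : ℕ) (p : MvPolynomial σ R) :
    map f (homogeneousComponent k p) = homogeneousComponent k (map f p) := by
  ext a
  simp only [coeff_map, coeff_homogeneousComponent, apply_ite f, map_zero]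

theorem IsBakerAkhiezer.exists_polynomial {φ : (Fin n → ℂ) → (Fin n → ℂ) → ℂ}
    (hφ : IsBakerAkhiezer A φ) : ∃ F, IsBakerAkhiezerPolynomial A F ∧
      ∀ x l, φ x l = eval x (map (eval l) F) * Complex.exp (x ⬝ᵥ l) := by
  choose P hdeg htop hform using hφ.form
  have hmem : ∀ l, P l ∈ quasiInvariants A l := fun l => by
    simpa only [hform, mem_quasiInvariants_iff_dirDeriv] using hφ.quasi l
  have hcont : ∀ x, Continuous fun l => eval x (P l) := by
    intro x
    have heval : ∀ l, eval x (P l) = φ x l * Complex.exp (-(x ⬝ᵥ l)) := fun l => by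
      rw [hform, mul_assoc, ← Complex.exp_add, add_neg_cancel, Complex.exp_zero, mul_one]
    simp only [heval]
    refine (hφ.continuous_param x).mul (Complex.continuous_exp.comp (Continuous.neg ?_))
    exact continuous_finsetSum _ fun i _ => continuous_const.mul (continuous_apply i)
  obtain ⟨F, hF, hFP⟩ := exists_map_eval_eq_of_mem_quasiInvariants hdeg htop hmem hcont
  refine ⟨F, ⟨hF, eq_of_map_eval_eq fun l => ?_, mem_quasiInvariants_X.2 fun l => ?_⟩,
    fun x l => ?_⟩
  · rw [map_homogeneousComponent, hFP, htop, map_mul, map_C, map_eval_map_C, A.eval_AmPoly]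
  · rw [hFP]
    exact hmem l
  · rw [hFP, hform]

theorem twist_rescale {R : Type*} [CommSemiring R] (t : R) (α l : Fin n → R)
    (p : MvPolynomial (Fin n) R) :
    twist α (t • l) (rescale t p) = t • rescale t (twist α l p) := by
  have hderiv : dirDerivation α (rescale t p) = t • rescale t (dirDerivation α p) := by
    simp only [dirDerivation_apply, pderiv_rescale, map_sum, map_smul, Finset.smul_sum,
      ← smul_eq_C_mul, smul_comm t]
  rw [twist_apply, twist_apply, hderiv, smul_dotProduct, map_add, map_smul, smul_add, smul_eq_mul,
    mul_smul]

theorem twist_pow_rescale {R : Type*} [CommSemiring R] (t : R) (α l : Fin n → R) (k : ℕ)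
    (p : MvPolynomial (Fin n) R) :
    (twist α (t • l) ^ k) (rescale t p) = t ^ k • rescale t ((twist α l ^ k) p) := by
  induction k with
  | zero => simp
  | succ k ih =>
    rw [pow_succ', Module.End.mul_apply, ih, map_smul, twist_rescale, smul_smul, ← pow_succ,
      ← Module.End.mul_apply, ← pow_succ']

theorem rescale_mem_quasiInvariants {l : Fin n → ℂ} {p : MvPolynomial (Fin n) ℂ}
    (hp : p ∈ quasiInvariants A l) (t : ℝ) :
    rescale (t : ℂ) p ∈ quasiInvariants A ((t : ℂ) • l) := by
  rw [mem_quasiInvariants] at hp ⊢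
  intro α hα s hs y hy
  have hty : (t : ℂ) • (algebraMap ℝ ℂ ∘ y) = algebraMap ℝ ℂ ∘ (t • y) :=
    (toComplex_smul t y).symm
  rw [twist_pow_rescale, smul_eval, eval_rescale, hty,
    hp α hα s hs (t • y) (by rw [smul_dotProduct, hy, smul_zero]), mul_zero]

theorem Am_smul (t : ℂ) (l : Fin n → ℂ) : A.Am (t • l) = t ^ A.totalMult * A.Am l := by
  simp only [Configuration.Am, Configuration.totalMult, smul_dotProduct, smul_eq_mul, mul_pow,
    Finset.prod_mul_distrib, Finset.prod_pow_eq_pow_sum]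

namespace IsBakerAkhiezerPolynomial

variable (hF : IsBakerAkhiezerPolynomial A F)

include hF

theorem totalDegree_map_eval_le (l : Fin n → ℂ) : (map (eval l) F).totalDegree ≤ A.totalMult :=
  (Finset.sup_mono (support_map_subset _ _)).trans hF.totalDegree_le

theorem homogeneousComponent_map_eval (l : Fin n → ℂ) :
    homogeneousComponent A.totalMult (map (eval l) F) = C (A.Am l) * A.AmPoly := by
  rw [← map_homogeneousComponent, hF.homogeneousComponent_eq, map_mul, map_C, map_eval_map_C,
    A.eval_AmPoly]

theorem map_eval_smul_of_Am_ne_zero {t : ℝ} (ht : t ≠ 0) {l : Fin n → ℂ} (hl : A.Am l ≠ 0) :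
    map (eval ((t : ℂ) • l)) F = rescale (t : ℂ) (map (eval l) F) := by
  have htl : A.Am ((t : ℂ) • l) ≠ 0 := by
    rw [Am_smul]
    exact mul_ne_zero (pow_ne_zero _ (Complex.ofReal_ne_zero.2 ht)) hl
  refine sub_eq_zero.1 (eq_zero_of_homogeneousComponent_eq_zero (sub_mem
    (mem_quasiInvariants_X.1 hF.mem_quasiInvariants _)
    (rescale_mem_quasiInvariants (mem_quasiInvariants_X.1 hF.mem_quasiInvariants l) t)) htl ?_ ?_)
  · exact (totalDegree_sub _ _).trans (max_le (hF.totalDegree_map_eval_le _)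
      ((totalDegree_rescale_le _ _).trans (hF.totalDegree_map_eval_le _)))
  · rw [map_sub, homogeneousComponent_rescale, hF.homogeneousComponent_map_eval,
      hF.homogeneousComponent_map_eval, Am_smul, C_mul, mul_assoc, sub_self]

theorem eval_map_eval_smul {t : ℝ} (ht : t ≠ 0) (x l : Fin n → ℂ) :
    eval x (map (eval ((t : ℂ) • l)) F) = eval ((t : ℂ) • x) (map (eval l) F) := by
  simp only [← eval_eval_C]
  refine eq_of_eq_of_eval_ne_zero (AmPoly_ne_zero A)
    (f := fun l => eval ((t : ℂ) • l) (eval (C ∘ x) F))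
    ((continuous_eval _).comp (continuous_const_smul _)) (continuous_eval _) (fun l hl => ?_) l
  rw [A.eval_AmPoly] at hl
  rw [eval_eval_C, hF.map_eval_smul_of_Am_ne_zero ht hl, eval_rescale, eval_eval_C]

theorem eval_C_smul {t : ℝ} (ht : t ≠ 0) (x l : Fin n → ℂ) :
    eval l (eval (C ∘ ((t : ℂ) • x)) F) = eval ((t : ℂ) • l) (eval (C ∘ x) F) := by
  rw [eval_eval_C, eval_eval_C, hF.eval_map_eval_smul ht]

theorem homogeneousComponent_eval_C (k : ℕ) (x l : Fin n → ℂ) :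
    eval l (homogeneousComponent k (eval (C ∘ x) F)) =
      eval x (homogeneousComponent k (map (eval l) F)) :=
  eval_homogeneousComponent_eq_of_forall_smul (fun t ht => by
    rw [eval_eval_C, hF.eval_map_eval_smul ht]) k

theorem eval_zero_eval_C (x l : Fin n → ℂ) :
    eval 0 (eval (C ∘ x) F) = eval 0 (map (eval l) F) := by
  simpa only [homogeneousComponent_zero, eval_C, ← constantCoeff_eq, ← eval_zero] using
    hF.homogeneousComponent_eval_C 0 x l

theorem eval_C_zero : eval (C ∘ (0 : Fin n → ℂ)) F = C (eval 0 (map (eval 0) F)) :=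
  funext fun l => by
    rw [eval_C, eval_eval_C, ← hF.eval_zero_eval_C 0 l, hF.eval_zero_eval_C 0 0]

theorem spectralOperator_eq_zero (h0 : eval 0 (map (eval 0) F) ≠ 0) : spectralOperator A F = 0 := by
  suffices hzero : C A.AmPoly * spectralOperator A F = 0 from
    (mul_eq_zero.1 hzero).resolve_left fun h =>
      AmPoly_ne_zero A (C_injective _ _ (h.trans C_0.symm))
  refine eq_of_map_eval_eq fun l => ?_
  rw [map_mul, map_C, A.eval_AmPoly, map_zero]
  rcases eq_or_ne (A.Am l) 0 with hl | hl
  · rw [hl, C_0, zero_mul]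
  have htop : homogeneousComponent A.totalMult (map (eval l) F) ≠ 0 := by
    rw [hF.homogeneousComponent_map_eval]
    exact mul_ne_zero (fun h => hl (C_injective _ _ (h.trans C_0.symm))) (AmPoly_ne_zero A)
  obtain ⟨κ, hκ⟩ := exists_eq_smul_of_homogeneousComponent_ne_zero
    (mem_quasiInvariants_X.1 (spectralOperator_mem_quasiInvariants hF.mem_quasiInvariants) l)
    (mem_quasiInvariants_X.1 hF.mem_quasiInvariants l) hl
    ((Finset.sup_mono (support_map_subset _ _)).trans
      (totalDegree_spectralOperator_le hF.totalDegree_le hF.homogeneousComponent_eq))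
    (hF.totalDegree_map_eval_le l) htop
  have hκ0 : κ * eval 0 (map (eval 0) F) = 0 := by
    have heval := congrArg (eval 0) hκ
    rwa [← eval_eval_C, eval_zero_spectralOperator hF.eval_C_zero, map_zero, smul_eval,
      ← eval_eval_C, hF.eval_C_zero, eval_C, eq_comm] at heval
  rw [hκ, (mul_eq_zero.1 hκ0).resolve_right h0, zero_smul, mul_zero]

end IsBakerAkhiezerPolynomial

end BakerAkhiezerPolynomials

section ExponentialGrowth

open scoped NNReal

variable {ι E : Type*} [SeminormedAddCommGroup E] {S : Set ι} {T : Set E} {G H : ι → E → ℂ}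

/-- The functions `G s`, `s ∈ S`, are continuous on `T` and at most of exponential growth there,
uniformly in `s`, so that one function integrable against a Gaussian dominates them all. -/
structure ExpGrowth (S : Set ι) (T : Set E) (G : ι → E → ℂ) : Prop where
  continuousOn : ∀ s ∈ S, ContinuousOn (G s) T
  bound : ∃ c k : ℝ≥0, ∀ s ∈ S, ∀ z ∈ T, ‖G s z‖ ≤ c * Real.exp (k * ‖z‖)

namespace ExpGrowth

theorem of_norm_le {R : ℝ} (hcont : ∀ s ∈ S, ContinuousOn (G s) T)
    (hR : ∀ s ∈ S, ∀ z ∈ T, ‖G s z‖ ≤ R) : ExpGrowth S T G :=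
  ⟨hcont, R.toNNReal, 0, fun s hs z hz => by
    simpa using (hR s hs z hz).trans (Real.le_coe_toNNReal R)⟩

theorem of_norm_le_mul_norm {R : ℝ} (hcont : ∀ s ∈ S, ContinuousOn (G s) T)
    (hR : ∀ s ∈ S, ∀ z ∈ T, ‖G s z‖ ≤ R * ‖z‖) : ExpGrowth S T G := by
  refine ⟨hcont, R.toNNReal, 1, fun s hs z hz => (hR s hs z hz).trans ?_⟩
  refine mul_le_mul (Real.le_coe_toNNReal R) ?_ (norm_nonneg z) R.toNNReal.2
  rw [NNReal.coe_one, one_mul]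
  linarith [Real.add_one_le_exp ‖z‖]

theorem exp_of_norm_le_mul_norm {R : ℝ} (hcont : ∀ s ∈ S, ContinuousOn (G s) T)
    (hR : ∀ s ∈ S, ∀ z ∈ T, ‖G s z‖ ≤ R * ‖z‖) : ExpGrowth S T fun s z => Complex.exp (G s z) := by
  refine ⟨fun s hs => (hcont s hs).cexp, 1, R.toNNReal, fun s hs z hz => ?_⟩
  rw [NNReal.coe_one, one_mul]
  exact (Complex.norm_exp_le_exp_norm _).trans (Real.exp_le_exp.2 ((hR s hs z hz).trans
    (mul_le_mul_of_nonneg_right (Real.le_coe_toNNReal R) (norm_nonneg z))))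

theorem const (a : ℂ) : ExpGrowth S T fun _ _ => a :=
  of_norm_le (R := ‖a‖) (fun _ _ => continuousOn_const) fun _ _ _ _ => le_rfl

theorem param {S : Set ℝ} {R : ℝ} (hS : ∀ s ∈ S, |s| ≤ R) : ExpGrowth S T fun s _ => (s : ℂ) :=
  of_norm_le (fun _ _ => continuousOn_const) fun s hs _ _ =>
    (Complex.norm_real s).trans_le (hS s hs)

theorem mul (hG : ExpGrowth S T G) (hH : ExpGrowth S T H) :
    ExpGrowth S T fun s z => G s z * H s z := by
  obtain ⟨c, k, hck⟩ := hG.bound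
  obtain ⟨c', k', hck'⟩ := hH.bound
  refine ⟨fun s hs => (hG.continuousOn s hs).mul (hH.continuousOn s hs), c * c', k + k',
    fun s hs z hz => ?_⟩
  rw [norm_mul, NNReal.coe_mul, NNReal.coe_add, add_mul, Real.exp_add, mul_mul_mul_comm]
  exact mul_le_mul (hck s hs z hz) (hck' s hs z hz) (norm_nonneg _) (by positivity)

theorem add (hG : ExpGrowth S T G) (hH : ExpGrowth S T H) :
    ExpGrowth S T fun s z => G s z + H s z := by
  obtain ⟨c, k, hck⟩ := hG.bound
  obtain ⟨c', k', hck'⟩ := hH.bound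
  refine ⟨fun s hs => (hG.continuousOn s hs).add (hH.continuousOn s hs), c + c', k + k',
    fun s hs z hz => (norm_add_le _ _).trans ?_⟩
  rw [NNReal.coe_add, add_mul]
  refine add_le_add ((hck s hs z hz).trans ?_) ((hck' s hs z hz).trans ?_)
  all_goals gcongr; simp

theorem sum {κ : Type*} {t : Finset κ} {G : κ → ι → E → ℂ} (hG : ∀ j, ExpGrowth S T (G j)) :
    ExpGrowth S T fun s z => ∑ j ∈ t, G j s z := by
  classical
  induction t using Finset.induction_on with
  | empty => simpa only [Finset.sum_empty] using const 0
  | insert j t hj ih => simpa only [Finset.sum_insert hj] using (hG j).add ih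

theorem prod {κ : Type*} {t : Finset κ} {G : κ → ι → E → ℂ}
    (hG : ∀ j ∈ t, ExpGrowth S T (G j)) : ExpGrowth S T fun s z => ∏ j ∈ t, G j s z := by
  classical
  induction t using Finset.induction_on with
  | empty => simpa only [Finset.prod_empty] using const 1
  | insert j t hj ih =>
    simpa only [Finset.prod_insert hj] using (hG j (Finset.mem_insert_self j t)).mul
      (ih fun i hi => hG i (Finset.mem_insert_of_mem hi))

theorem pow (hG : ExpGrowth S T G) (m : ℕ) : ExpGrowth S T fun s z => G s z ^ m := by
  simpa only [Finset.prod_const, Finset.card_range] using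
    prod (t := Finset.range m) fun _ _ => hG

theorem eval {σ : Type*} {u : ι → E → σ → ℂ} (hu : ∀ i, ExpGrowth S T fun s z => u s z i)
    (p : MvPolynomial σ ℂ) : ExpGrowth S T fun s z => MvPolynomial.eval (u s z) p := by
  induction p using MvPolynomial.induction_on with
  | C a => simpa only [eval_C] using const a
  | add p q hp hq => simpa only [map_add] using hp.add hq
  | mul_X p j hp => simpa only [map_mul, eval_X] using hp.mul (hu j)

theorem coord {σ : Type*} [Fintype σ] {T : Set (σ → ℂ)} (i : σ) : ExpGrowth S T fun _ z => z i :=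
  of_norm_le_mul_norm (R := 1) (fun _ _ => (continuous_apply i).continuousOn) fun _ _ z _ => by
    simpa using norm_le_pi_norm z i

end ExpGrowth

end ExponentialGrowth

section GaussianMeasure

variable {n : ℕ} {ξ : Fin n → ℝ}

theorem shift_dotProduct_toComplex (ξ y α : Fin n → ℝ) : shift ξ y ⬝ᵥ toComplex α =
    ((y ⬝ᵥ α : ℝ) : ℂ) + Complex.I * ((ξ ⬝ᵥ α : ℝ) : ℂ) := by
  rw [shift, add_dotProduct, smul_dotProduct, toComplex_dotProduct, toComplex_dotProduct,
    smul_eq_mul]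

theorem shift_dotProduct_shift (ξ y : Fin n → ℝ) : shift ξ y ⬝ᵥ shift ξ y =
    ((y ⬝ᵥ y - ξ ⬝ᵥ ξ : ℝ) : ℂ) + 2 * Complex.I * ((y ⬝ᵥ ξ : ℝ) : ℂ) := by
  nth_rw 2 [shift]
  rw [dotProduct_add, dotProduct_smul, shift_dotProduct_toComplex, shift_dotProduct_toComplex,
    dotProduct_comm ξ y, smul_eq_mul]
  push_cast
  linear_combination ((ξ ⬝ᵥ ξ : ℝ) : ℂ) * Complex.I_sq

theorem continuous_shift (ξ : Fin n → ℝ) : Continuous (shift ξ) := by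
  unfold shift toComplex
  fun_prop

theorem norm_shift_le (ξ y : Fin n → ℝ) : ‖shift ξ y‖ ≤ ‖y‖ + ‖ξ‖ := by
  have hnorm : ∀ v : Fin n → ℝ, ‖toComplex v‖ = ‖v‖ := fun v => by
    simp only [Pi.norm_def, toComplex, Complex.nnnorm_real]
  refine (norm_add_le _ _).trans ?_
  rw [norm_smul, Complex.norm_I, one_mul, hnorm, hnorm]

theorem continuous_gaussianDensity : Continuous (gaussianDensity : (Fin n → ℂ) → ℂ) := by
  unfold gaussianDensity dotProduct
  fun_prop

theorem norm_gaussianDensity_shift (ξ y : Fin n → ℝ) : ‖gaussianDensity (shift ξ y)‖ =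
    (2 * Real.pi) ^ (-(n : ℝ) / 2) * Real.exp ((ξ ⬝ᵥ ξ) / 2) * Real.exp (-(y ⬝ᵥ y) / 2) := by
  have hre : (-(shift ξ y ⬝ᵥ shift ξ y) / 2).re = (ξ ⬝ᵥ ξ) / 2 + -(y ⬝ᵥ y) / 2 := by
    rw [shift_dotProduct_shift]
    simp
    ring
  rw [gaussianDensity, norm_mul, Complex.norm_exp, hre, Real.exp_add, Complex.norm_real,
    Real.norm_of_nonneg (by positivity), mul_assoc]

theorem sq_norm_le_dotProduct_self (y : Fin n → ℝ) : ‖y‖ ^ 2 ≤ y ⬝ᵥ y := by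
  have hnorm : ‖y‖ ≤ √(y ⬝ᵥ y) := by
    refine (pi_norm_le_iff_of_nonneg (Real.sqrt_nonneg _)).2 fun i => Real.le_sqrt_of_sq_le ?_
    rw [Real.norm_eq_abs, sq_abs, sq]
    exact Finset.single_le_sum (f := fun j => y j * y j) (fun j _ => mul_self_nonneg _)
      (Finset.mem_univ i)
  exact (Real.le_sqrt (norm_nonneg y) (Finset.sum_nonneg fun j _ => mul_self_nonneg (y j))).1 hnorm

theorem integrable_exp_mul_norm_gaussianDensity (ξ : Fin n → ℝ) (k : ℝ) :
    Integrable fun y : Fin n → ℝ => Real.exp (k * ‖y‖) * ‖gaussianDensity (shift ξ y)‖ := by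
  have hgauss : Integrable fun y : Fin n → ℝ => Real.exp (-(1 / 4) * (y ⬝ᵥ y)) := by
    have hprod : Integrable fun y : Fin n → ℝ => ∏ i, Real.exp (-(1 / 4) * y i ^ 2) :=
      Integrable.fintype_prod fun _ => integrable_exp_neg_mul_sq (by norm_num)
    simpa only [dotProduct, Finset.mul_sum, Real.exp_sum, sq] using hprod
  refine (hgauss.const_mul ((2 * Real.pi) ^ (-(n : ℝ) / 2) * Real.exp ((ξ ⬝ᵥ ξ) / 2) *
    Real.exp (k ^ 2))).mono' ?_ (ae_of_all _ fun y => ?_)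
  · have := continuous_gaussianDensity.comp (continuous_shift ξ)
    exact ((Real.continuous_exp.comp (continuous_norm.const_mul k)).mul
      this.norm).aestronglyMeasurable
  · rw [Real.norm_of_nonneg (by positivity), norm_gaussianDensity_shift, mul_left_comm,
      ← Real.exp_add, mul_assoc _ (Real.exp (k ^ 2)), ← Real.exp_add]
    refine mul_le_mul_of_nonneg_left (Real.exp_le_exp.2 ?_) (by positivity)
    nlinarith [sq_norm_le_dotProduct_self y, sq_nonneg (k - ‖y‖ / 2)]

theorem gaussianIntegral_one (ξ : Fin n → ℝ) : gaussianIntegral ξ (fun _ => 1) = 1 := by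
  have hdensity : ∀ y : Fin n → ℝ, 1 * gaussianDensity (shift ξ y) =
      (((2 * Real.pi) ^ (-(n : ℝ) / 2) : ℝ) : ℂ) * Complex.exp ((ξ ⬝ᵥ ξ : ℝ) / 2) *
        Complex.exp (-(1 / 2 : ℂ) * ∑ i, (y i : ℂ) ^ 2 + ∑ i, (-Complex.I * ξ i) * y i) := by
    intro y
    rw [one_mul, gaussianDensity, shift_dotProduct_shift, mul_assoc (Complex.ofReal _),
      ← Complex.exp_add]
    simp only [dotProduct, Complex.ofReal_sub, Complex.ofReal_sum, Complex.ofReal_mul, mul_assoc,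
      ← Finset.mul_sum, mul_comm (ξ _ : ℂ), sq]
    congr 2
    ring
  have hsq : ∑ i, (-Complex.I * (ξ i : ℂ)) ^ 2 = -((ξ ⬝ᵥ ξ : ℝ) : ℂ) := by
    simp [mul_pow, dotProduct, ← sq]
  have hpi : (Real.pi / (1 / 2) : ℂ) ^ (Fintype.card (Fin n) / 2 : ℂ) =
      (((2 * Real.pi) ^ ((n : ℝ) / 2) : ℝ) : ℂ) := by
    rw [Complex.ofReal_cpow (by positivity), Fintype.card_fin]
    push_cast
    rw [div_div_eq_mul_div, div_one, mul_comm]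
  rw [gaussianIntegral, integral_congr_ae (ae_of_all _ hdensity), integral_const_mul,
    GaussianFourier.integral_cexp_neg_mul_sum_add (by norm_num), hsq, hpi, mul_mul_mul_comm,
    ← Complex.exp_add, ← Complex.ofReal_mul, ← Real.rpow_add (by positivity), neg_div,
    neg_add_cancel, Real.rpow_zero, Complex.ofReal_one, one_mul, Complex.exp_eq_one_iff]
  exact ⟨0, by ring⟩

theorem gaussianIntegral_mul_exp_dotProduct (ξ v : Fin n → ℝ) (F : (Fin n → ℂ) → ℂ) :
    gaussianIntegral ξ (fun z => F z * Complex.exp (z ⬝ᵥ toComplex v)) =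
      Complex.exp ((v ⬝ᵥ v : ℝ) / 2) * gaussianIntegral ξ fun z => F (z + toComplex v) := by
  have hshift : ∀ y, shift ξ (y + v) = shift ξ y + toComplex v := fun y => by
    funext i
    simp [shift, toComplex]
    ring
  have hdensity : ∀ z : Fin n → ℂ, Complex.exp ((z + toComplex v) ⬝ᵥ toComplex v) *
      gaussianDensity (z + toComplex v) = Complex.exp ((v ⬝ᵥ v : ℝ) / 2) * gaussianDensity z := by
    intro z
    rw [gaussianDensity, gaussianDensity, mul_left_comm, mul_left_comm (Complex.exp _),
      ← Complex.exp_add, ← Complex.exp_add]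
    congr 2
    simp only [add_dotProduct, dotProduct_add, toComplex_dotProduct,
      dotProduct_comm (toComplex v) z]
    ring
  rw [gaussianIntegral, gaussianIntegral, ← integral_add_right_eq_self _ v, ← integral_const_mul]
  refine integral_congr_ae (ae_of_all _ fun y => ?_)
  simp only [hshift]
  rw [mul_assoc, hdensity, mul_left_comm]

end GaussianMeasure

section DominatedConvergence

variable {n : ℕ} {ξ : Fin n → ℝ} {ι : Type*} {S : Set ι} {G : ι → (Fin n → ℂ) → ℂ}

theorem ExpGrowth.exists_integrable_bound (hG : ExpGrowth S (Set.range (shift ξ)) G) :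
    ∃ b : (Fin n → ℝ) → ℝ, Integrable b ∧
      ∀ s ∈ S, ∀ y, ‖G s (shift ξ y) * gaussianDensity (shift ξ y)‖ ≤ b y := by
  obtain ⟨c, k, hck⟩ := hG.bound
  refine ⟨_, (integrable_exp_mul_norm_gaussianDensity ξ k).const_mul (c * Real.exp (k * ‖ξ‖)),
    fun s hs y => ?_⟩
  rw [norm_mul, ← mul_assoc, mul_assoc (c : ℝ), ← Real.exp_add, ← mul_add, add_comm ‖ξ‖]
  refine mul_le_mul_of_nonneg_right ((hck s hs _ ⟨y, rfl⟩).trans ?_) (norm_nonneg _)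
  gcongr
  exact norm_shift_le ξ y

theorem ExpGrowth.aestronglyMeasurable (hG : ExpGrowth S (Set.range (shift ξ)) G) {s : ι}
    (hs : s ∈ S) :
    AEStronglyMeasurable fun y => G s (shift ξ y) * gaussianDensity (shift ξ y) :=
  (((hG.continuousOn s hs).comp_continuous (continuous_shift ξ) fun y => ⟨y, rfl⟩).mul
    (continuous_gaussianDensity.comp (continuous_shift ξ))).aestronglyMeasurable

theorem ExpGrowth.gaussianIntegrable (hG : ExpGrowth S (Set.range (shift ξ)) G) {s : ι}
    (hs : s ∈ S) : GaussianIntegrable ξ (G s) := by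
  obtain ⟨b, hb, hGb⟩ := hG.exists_integrable_bound
  exact hb.mono' (hG.aestronglyMeasurable hs) (ae_of_all _ (hGb s hs))

theorem ExpGrowth.tendsto_gaussianIntegral (hG : ExpGrowth S (Set.range (shift ξ)) G)
    {l : Filter ι} [l.IsCountablyGenerated] (hS : S ∈ l) {g : (Fin n → ℂ) → ℂ}
    (hlim : ∀ z, Tendsto (fun s => G s z) l (𝓝 (g z))) :
    Tendsto (fun s => gaussianIntegral ξ (G s)) l (𝓝 (gaussianIntegral ξ g)) := by
  obtain ⟨b, hb, hGb⟩ := hG.exists_integrable_bound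
  refine tendsto_integral_filter_of_dominated_convergence b ?_ ?_ hb
    (ae_of_all _ fun y => (hlim _).mul_const _)
  · filter_upwards [hS] with s hs using hG.aestronglyMeasurable hs
  · filter_upwards [hS] with s hs using ae_of_all _ (hGb s hs)

theorem ExpGrowth.hasDerivAt_gaussianIntegral {S : Set ℝ} {G G' : ℝ → (Fin n → ℂ) → ℂ}
    (hG : ExpGrowth S (Set.range (shift ξ)) G) (hG' : ExpGrowth S (Set.range (shift ξ)) G') {s : ℝ}
    (hS : S ∈ 𝓝 s) (hderiv : ∀ t z, HasDerivAt (fun t => G t z) (G' t z) t) :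
    HasDerivAt (fun t => gaussianIntegral ξ (G t)) (gaussianIntegral ξ (G' s)) s := by
  obtain ⟨b, hb, hGb⟩ := hG'.exists_integrable_bound
  refine (hasDerivAt_integral_of_dominated_loc_of_deriv_le
    (F := fun t y => G t (shift ξ y) * gaussianDensity (shift ξ y))
    (F' := fun t y => G' t (shift ξ y) * gaussianDensity (shift ξ y)) hS ?_
    (hG.gaussianIntegrable (mem_of_mem_nhds hS)) (hG'.aestronglyMeasurable (mem_of_mem_nhds hS))
    (ae_of_all _ fun y t ht => hGb t ht y) hb
    (ae_of_all _ fun y t _ => (hderiv t (shift ξ y)).mul_const _)).2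
  filter_upwards [hS] with t ht using hG.aestronglyMeasurable ht

end DominatedConvergence

section GaussianIntegrationByParts

variable {n : ℕ} {ξ : Fin n → ℝ}

theorem gaussianIntegral_congr {F G : (Fin n → ℂ) → ℂ} (h : ∀ y, F (shift ξ y) = G (shift ξ y)) :
    gaussianIntegral ξ F = gaussianIntegral ξ G :=
  integral_congr_ae (ae_of_all _ fun y => by simp only [h])

theorem gaussianIntegral_const_mul (a : ℂ) (F : (Fin n → ℂ) → ℂ) :
    gaussianIntegral ξ (fun z => a * F z) = a * gaussianIntegral ξ F := by
  simp only [gaussianIntegral, mul_assoc, integral_const_mul]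

theorem gaussianIntegral_sum {κ : Type*} {t : Finset κ} {F : κ → (Fin n → ℂ) → ℂ}
    (hF : ∀ j ∈ t, GaussianIntegrable ξ (F j)) :
    gaussianIntegral ξ (fun z => ∑ j ∈ t, F j z) = ∑ j ∈ t, gaussianIntegral ξ (F j) := by
  simp only [gaussianIntegral, Finset.sum_mul]
  exact integral_finsetSum t hF

theorem shift_add_smul (y v : Fin n → ℝ) (t : ℝ) :
    shift ξ (y + t • v) = shift ξ y + (t : ℂ) • toComplex v := by
  funext i
  simp [shift, toComplex]
  ring

theorem hasDerivAt_add_smul (z v : Fin n → ℂ) (i : Fin n) (t : ℝ) :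
    HasDerivAt (fun s : ℝ => (z + (s : ℂ) • v) i) (v i) t := by
  simpa using (((hasDerivAt_id t).ofReal_comp).mul_const (v i)).const_add (z i)

theorem hasDerivAt_gaussianDensity (z v : Fin n → ℂ) :
    HasDerivAt (fun t : ℝ => gaussianDensity (z + (t : ℂ) • v))
      (-(z ⬝ᵥ v) * gaussianDensity z) 0 := by
  have hsq : HasDerivAt (fun t : ℝ => (z + (t : ℂ) • v) ⬝ᵥ (z + (t : ℂ) • v)) (2 * (z ⬝ᵥ v)) 0 := by
    refine (HasDerivAt.fun_sum fun i _ =>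
      (hasDerivAt_add_smul z v i 0).mul (hasDerivAt_add_smul z v i 0)).congr_deriv ?_
    rw [dotProduct, Finset.mul_sum]
    exact Finset.sum_congr rfl fun i _ => by simp; ring
  refine (((hsq.neg.div_const 2).cexp).const_mul _).congr_deriv ?_
  simp only [gaussianDensity, Pi.neg_apply, Complex.ofReal_zero, zero_smul, add_zero]
  ring

theorem integral_eq_zero_of_hasLineDerivAt {f f' : (Fin n → ℝ) → ℂ} (v : Fin n → ℝ)
    (hf : Integrable f) (hf' : Integrable f') (h : ∀ x, HasLineDerivAt ℝ f (f' x) x v) :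
    ∫ x, f' x = 0 := by
  simpa using (integral_bilinear_hasLineDerivAt_right_eq_neg_left_of_integrable (μ := volume)
    (f := f) (f' := f') (g := fun _ => (1 : ℂ)) (g' := fun _ => 0) (v := v)
    (B := ContinuousLinearMap.mul ℝ ℂ) (by simpa using hf') (by simp) (by simpa using hf)
    (fun x _ => h x) (fun x _ => hasDerivAt_const _ _)).symm

theorem gaussianIntegral_eq_gaussianIntegral_dotProduct_mul {F F' : (Fin n → ℂ) → ℂ}
    (v : Fin n → ℝ) (hF : GaussianIntegrable ξ F) (hF' : GaussianIntegrable ξ F')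
    (hvF : GaussianIntegrable ξ fun z => z ⬝ᵥ toComplex v * F z)
    (hderiv : ∀ y, HasDerivAt (fun t : ℝ => F (shift ξ y + (t : ℂ) • toComplex v))
      (F' (shift ξ y)) 0) :
    gaussianIntegral ξ F' = gaussianIntegral ξ fun z => z ⬝ᵥ toComplex v * F z := by
  rw [gaussianIntegral, gaussianIntegral, ← sub_eq_zero, ← integral_sub hF' hvF]
  refine integral_eq_zero_of_hasLineDerivAt v hF (hF'.sub hvF) fun y => ?_
  rw [HasLineDerivAt]
  simp only [shift_add_smul]
  refine ((hderiv y).mul (hasDerivAt_gaussianDensity (shift ξ y) (toComplex v))).congr_deriv ?_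
  simp only [Complex.ofReal_zero, zero_smul, add_zero]
  ring

end GaussianIntegrationByParts

section WeightedExponential

variable {n : ℕ} {A : Configuration n} {ξ : Fin n → ℝ}

/-- The function `p(z) exp (z, x) / A_m(z)²` of `z`. -/
def weightedExp (A : Configuration n) (x : Fin n → ℂ) (p : MvPolynomial (Fin n) ℂ)
    (z : Fin n → ℂ) : ℂ :=
  eval z p * Complex.exp (z ⬝ᵥ x) * (A.Am z)⁻¹ ^ 2

theorem ExpGrowth.inv_Am {ι E : Type*} [SeminormedAddCommGroup E] {S : Set ι} {T : Set E}
    {u : ι → E → Fin n → ℂ}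
    (hu : ∀ α ∈ A.vectors, ExpGrowth S T fun s z => (u s z ⬝ᵥ toComplex α)⁻¹) :
    ExpGrowth S T fun s z => (A.Am (u s z))⁻¹ := by
  simpa only [Configuration.Am, ← Finset.prod_inv_distrib, ← inv_pow] using
    ExpGrowth.prod fun α hα => (hu α hα).pow (A.mult α)

theorem abs_le_norm_shift_dotProduct_toComplex (y α : Fin n → ℝ) :
    |ξ ⬝ᵥ α| ≤ ‖shift ξ y ⬝ᵥ toComplex α‖ := by
  refine le_trans (le_of_eq ?_) (Complex.abs_im_le_norm _)
  simp [shift_dotProduct_toComplex]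

theorem shift_dotProduct_toComplex_ne_zero {α : Fin n → ℝ} (hα : ξ ⬝ᵥ α ≠ 0) (y : Fin n → ℝ) :
    shift ξ y ⬝ᵥ toComplex α ≠ 0 :=
  norm_pos_iff.1 ((abs_pos.2 hα).trans_le (abs_le_norm_shift_dotProduct_toComplex y α))

theorem Am_shift_ne_zero (hξ : ∀ α ∈ A.vectors, ξ ⬝ᵥ α ≠ 0) (y : Fin n → ℝ) :
    A.Am (shift ξ y) ≠ 0 :=
  Finset.prod_ne_zero_iff.2 fun α hα =>
    pow_ne_zero _ (shift_dotProduct_toComplex_ne_zero (hξ α hα) y)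

theorem expGrowth_inv_Am {ι : Type*} {S : Set ι} (hξ : ∀ α ∈ A.vectors, ξ ⬝ᵥ α ≠ 0) :
    ExpGrowth S (Set.range (shift ξ)) fun _ z => (A.Am z)⁻¹ := by
  refine ExpGrowth.inv_Am (u := fun _ z => z) fun α hα =>
    ExpGrowth.of_norm_le (R := |ξ ⬝ᵥ α|⁻¹) (fun _ _ => ContinuousOn.inv₀ ?_ ?_) ?_
  · exact (continuous_id.dotProduct continuous_const).continuousOn
  · rintro _ ⟨y, rfl⟩
    exact shift_dotProduct_toComplex_ne_zero (hξ α hα) y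
  · rintro _ _ _ ⟨y, rfl⟩
    rw [norm_inv]
    exact inv_anti₀ (abs_pos.2 (hξ α hα)) (abs_le_norm_shift_dotProduct_toComplex y α)

theorem norm_dotProduct_le_card_mul (z x : Fin n → ℂ) : ‖z ⬝ᵥ x‖ ≤ n * ‖x‖ * ‖z‖ := by
  calc ‖z ⬝ᵥ x‖ ≤ ∑ _i : Fin n, ‖z‖ * ‖x‖ := norm_sum_le_of_le _ fun i _ =>
        (norm_mul_le _ _).trans (mul_le_mul (norm_le_pi_norm z i) (norm_le_pi_norm x i)
          (norm_nonneg _) (norm_nonneg _))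
    _ = n * ‖x‖ * ‖z‖ := by
      rw [Finset.sum_const, Finset.card_univ, Fintype.card_fin, nsmul_eq_mul]
      ring

theorem expGrowth_exp_dotProduct {ι : Type*} {S : Set ι} {T : Set (Fin n → ℂ)} {x : ι → Fin n → ℂ}
    {R : ℝ} (hx : ∀ s ∈ S, ‖x s‖ ≤ R) : ExpGrowth S T fun s z => Complex.exp (z ⬝ᵥ x s) := by
  refine ExpGrowth.exp_of_norm_le_mul_norm (R := n * R) (fun s _ =>
    (continuous_id.dotProduct continuous_const).continuousOn) fun s hs z _ => ?_
  refine (norm_dotProduct_le_card_mul z (x s)).trans ?_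
  gcongr
  exact hx s hs

theorem expGrowth_weightedExp {ι : Type*} {S : Set ι} (hξ : ∀ α ∈ A.vectors, ξ ⬝ᵥ α ≠ 0)
    {x : ι → Fin n → ℂ} {R : ℝ} (hx : ∀ s ∈ S, ‖x s‖ ≤ R) {p : ι → MvPolynomial (Fin n) ℂ}
    (hp : ExpGrowth S (Set.range (shift ξ)) fun s z => eval z (p s)) :
    ExpGrowth S (Set.range (shift ξ)) fun s => weightedExp A (x s) (p s) :=
  (hp.mul (expGrowth_exp_dotProduct hx)).mul ((expGrowth_inv_Am hξ).pow 2)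

theorem expGrowth_weightedExp_const (hξ : ∀ α ∈ A.vectors, ξ ⬝ᵥ α ≠ 0) (x : Fin n → ℂ)
    (p : MvPolynomial (Fin n) ℂ) :
    ExpGrowth (Set.univ : Set Unit) (Set.range (shift ξ)) fun _ => weightedExp A x p :=
  expGrowth_weightedExp hξ (fun _ _ => le_rfl) (ExpGrowth.eval (fun i => ExpGrowth.coord i) p)

theorem hasDerivAt_weightedExp_add_smul (x : Fin n → ℂ) (p : MvPolynomial (Fin n) ℂ)
    {z : Fin n → ℂ} (hz : A.Am z ≠ 0) (i : Fin n) :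
    HasDerivAt (fun t : ℝ => weightedExp A x p (z + (t : ℂ) • Pi.single i 1))
      (weightedExp A x (A.AmPoly * expPderiv x i p - 2 * (pderiv i A.AmPoly * p)) z *
        (A.Am z)⁻¹) 0 := by
  have hsingle : ∀ g : Fin n → ℂ, ∑ j, (Pi.single i 1 : Fin n → ℂ) j * g j = g i := fun g => by
    simp [Pi.single_apply]
  have hline := fun j => hasDerivAt_add_smul z (Pi.single i 1) j 0
  have hnum := hasDerivAt_eval_mul_exp p x hline
  have hden := hasDerivAt_eval A.AmPoly hline
  simp only [Complex.ofReal_zero, zero_smul, add_zero, hsingle, A.eval_AmPoly] at hnum hden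
  refine (hnum.mul ((hden.inv (by simpa using hz)).pow 2)).congr_deriv ?_
  simp only [weightedExp, Complex.ofReal_zero, zero_smul, add_zero, map_sub, map_mul, map_ofNat,
    A.eval_AmPoly, Pi.inv_apply, Pi.pow_apply, Nat.add_one_sub_one, pow_one, Nat.cast_ofNat]
  field_simp
  ring

theorem gaussianIntegral_weightedExp_expPderiv (hξ : ∀ α ∈ A.vectors, ξ ⬝ᵥ α ≠ 0) (x : Fin n → ℂ)
    (p : MvPolynomial (Fin n) ℂ) (i : Fin n) :
    gaussianIntegral ξ (fun z =>
        weightedExp A x (A.AmPoly * expPderiv x i p - 2 * (pderiv i A.AmPoly * p)) z * (A.Am z)⁻¹) =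
      gaussianIntegral ξ fun z => z i * weightedExp A x p z := by
  have hsingle : toComplex (Pi.single i 1) = (Pi.single i 1 : Fin n → ℂ) := by
    funext j
    simp [toComplex, Pi.single_apply, apply_ite Complex.ofReal]
  have hgrowth := expGrowth_weightedExp_const hξ x p
  have hparts := gaussianIntegral_eq_gaussianIntegral_dotProduct_mul (ξ := ξ) (Pi.single i 1)
    (hgrowth.gaussianIntegrable (Set.mem_univ ()))
    (((expGrowth_weightedExp_const hξ x _).mul (expGrowth_inv_Am hξ)).gaussianIntegrable
      (Set.mem_univ ()))
    (by simpa only [hsingle, dotProduct_single_one] using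
      ((ExpGrowth.coord i).mul hgrowth).gaussianIntegrable (Set.mem_univ ()))
    fun y => by
      rw [hsingle]
      exact hasDerivAt_weightedExp_add_smul x p (Am_shift_ne_zero hξ y) i
  simpa only [hsingle, dotProduct_single_one] using hparts

theorem gaussianIntegral_sum_mul_weightedExp (hξ : ∀ α ∈ A.vectors, ξ ⬝ᵥ α ≠ 0) {x : Fin n → ℂ}
    {p : MvPolynomial (Fin n) ℂ} (hp : spectralDefect A x p = 0) :
    gaussianIntegral ξ (fun z => ∑ i, z i * weightedExp A x (expPderiv x i p) z) =
      x ⬝ᵥ x * gaussianIntegral ξ (weightedExp A x p) := by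
  have hpoly : ∑ i, (A.AmPoly * expPderiv x i (expPderiv x i p) -
      2 * (pderiv i A.AmPoly * expPderiv x i p)) = A.AmPoly * (C (x ⬝ᵥ x) * p) := by
    rw [Finset.sum_sub_distrib, ← Finset.mul_sum, ← Finset.mul_sum]
    rw [spectralDefect] at hp
    linear_combination hp
  rw [gaussianIntegral_sum fun i _ => ((ExpGrowth.coord i).mul
    (expGrowth_weightedExp_const hξ x _)).gaussianIntegrable (Set.mem_univ ())]
  simp only [← gaussianIntegral_weightedExp_expPderiv hξ]
  rw [← gaussianIntegral_sum fun i _ => ((expGrowth_weightedExp_const hξ x _).mul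
    (expGrowth_inv_Am hξ)).gaussianIntegrable (Set.mem_univ ()), ← gaussianIntegral_const_mul]
  refine gaussianIntegral_congr fun y => ?_
  simp only [weightedExp, ← Finset.sum_mul, ← map_sum, hpoly]
  rw [map_mul, map_mul, eval_C, A.eval_AmPoly]
  have := Am_shift_ne_zero hξ y
  field_simp

end WeightedExponential

section RadialEquation

variable {n : ℕ} {A : Configuration n} {ξ : Fin n → ℝ}

theorem expPderiv_rescale {σ R : Type*} [CommSemiring R] (t : R) (x : σ → R) (i : σ)
    (p : MvPolynomial σ R) :
    expPderiv (t • x) i (rescale t p) = C t * rescale t (expPderiv x i p) := by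
  rw [expPderiv, expPderiv, pderiv_rescale, map_add, map_mul, Pi.smul_apply, smul_eq_mul, C_mul,
    show rescale t (C (x i)) = C (x i) from algHom_C _ _]
  ring

theorem hasDerivAt_weightedExp_rescale (x z : Fin n → ℂ) (p : MvPolynomial (Fin n) ℂ) (s : ℝ) :
    HasDerivAt (fun t : ℝ => weightedExp A ((t : ℂ) • x) (rescale (t : ℂ) p) z)
      (∑ i, z i * weightedExp A ((s : ℂ) • x) (rescale (s : ℂ) (expPderiv x i p)) z) s := by
  have hray : ∀ i, HasDerivAt (fun t : ℝ => ((t : ℂ) • z) i) (z i) s := fun i => by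
    simpa using ((hasDerivAt_id s).ofReal_comp).mul_const (z i)
  simp only [weightedExp, eval_rescale, dotProduct_smul, ← smul_dotProduct, ← mul_assoc,
    ← Finset.sum_mul]
  exact (hasDerivAt_eval_mul_exp p x hray).mul_const _

theorem hasDerivAt_gaussianIntegral_weightedExp (hξ : ∀ α ∈ A.vectors, ξ ⬝ᵥ α ≠ 0) (x : Fin n → ℂ)
    (p : MvPolynomial (Fin n) ℂ) (s : ℝ) :
    HasDerivAt (fun t : ℝ => gaussianIntegral ξ (weightedExp A ((t : ℂ) • x) (rescale (t : ℂ) p)))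
      (gaussianIntegral ξ fun z =>
        ∑ i, z i * weightedExp A ((s : ℂ) • x) (rescale (s : ℂ) (expPderiv x i p)) z) s := by
  have habs : ∀ t ∈ Metric.ball s 1, |t| ≤ |s| + 1 := fun t ht => by
    have := abs_sub_abs_le_abs_sub t s
    rw [Metric.mem_ball, Real.dist_eq] at ht
    linarith
  have hgrowth : ∀ q, ExpGrowth (Metric.ball s 1) (Set.range (shift ξ)) fun t : ℝ =>
      weightedExp A ((t : ℂ) • x) (rescale (t : ℂ) q) := fun q => by
    refine expGrowth_weightedExp hξ (R := (|s| + 1) * ‖x‖) (fun t ht => ?_) ?_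
    · rw [norm_smul, Complex.norm_real]
      exact mul_le_mul_of_nonneg_right (habs t ht) (norm_nonneg x)
    · simp only [eval_rescale]
      exact ExpGrowth.eval (fun i => (ExpGrowth.param habs).mul (ExpGrowth.coord i)) q
  exact (hgrowth p).hasDerivAt_gaussianIntegral
    (ExpGrowth.sum fun i => (ExpGrowth.coord i).mul (hgrowth (expPderiv x i p)))
    (Metric.ball_mem_nhds s one_pos) fun t z => hasDerivAt_weightedExp_rescale x z p t

theorem hasDerivAt_gaussianIntegral_weightedExp_of_spectralDefect_eq_zero
    (hξ : ∀ α ∈ A.vectors, ξ ⬝ᵥ α ≠ 0) {x : Fin n → ℂ} {p : MvPolynomial (Fin n) ℂ}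
    (hp : ∀ t : ℝ, t ≠ 0 → spectralDefect A ((t : ℂ) • x) (rescale (t : ℂ) p) = 0) (s : ℝ) :
    HasDerivAt (fun t : ℝ => gaussianIntegral ξ (weightedExp A ((t : ℂ) • x) (rescale (t : ℂ) p)))
      (s * (x ⬝ᵥ x) * gaussianIntegral ξ (weightedExp A ((s : ℂ) • x) (rescale (s : ℂ) p))) s := by
  have hderiv := hasDerivAt_gaussianIntegral_weightedExp hξ x p
  have hne : ∀ t : ℝ, t ≠ 0 → HasDerivAt
      (fun t : ℝ => gaussianIntegral ξ (weightedExp A ((t : ℂ) • x) (rescale (t : ℂ) p)))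
      (t * (x ⬝ᵥ x) * gaussianIntegral ξ (weightedExp A ((t : ℂ) • x) (rescale (t : ℂ) p))) t := by
    intro t ht
    refine (hderiv t).congr_deriv (mul_left_cancel₀ (Complex.ofReal_ne_zero.2 ht) ?_)
    have hparts := gaussianIntegral_sum_mul_weightedExp hξ (hp t ht)
    simp only [expPderiv_rescale] at hparts
    rw [← gaussianIntegral_const_mul]
    convert hparts using 1
    · congr 1
      funext z
      simp only [weightedExp, map_mul, eval_C, Finset.mul_sum]
      exact Finset.sum_congr rfl fun i _ => by ring
    · rw [smul_dotProduct, dotProduct_smul, smul_eq_mul, smul_eq_mul]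
      ring
  have hcont : Continuous fun t : ℝ =>
      gaussianIntegral ξ (weightedExp A ((t : ℂ) • x) (rescale (t : ℂ) p)) :=
    continuous_iff_continuousAt.2 fun t => (hderiv t).continuousAt
  rcases eq_or_ne s 0 with rfl | hs
  · exact hasDerivAt_of_hasDerivAt_of_ne hne hcont.continuousAt
      ((Complex.continuous_ofReal.mul continuous_const).mul hcont).continuousAt
  · exact hne s hs

theorem eq_of_hasDerivAt_mul_of_tendsto {f : ℝ → ℂ} {a c : ℂ}
    (hf : ∀ s : ℝ, HasDerivAt f (s * a * f s) s)
    (hlim : Tendsto (fun s : ℝ => Complex.exp (-(s ^ 2 * a / 2)) * f s) atTop (𝓝 c)) :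
    f 0 = c := by
  have hderiv : ∀ s : ℝ,
      HasDerivAt (fun s : ℝ => Complex.exp (-(s ^ 2 * a / 2)) * f s) 0 s := fun s => by
    have hsq := (((((hasDerivAt_id s).ofReal_comp).pow 2).mul_const a).div_const 2).neg.cexp
    refine (hsq.mul (hf s)).congr_deriv ?_
    simp
    ring
  have hconst : ∀ s : ℝ, Complex.exp (-(s ^ 2 * a / 2)) * f s = f 0 := fun s => by
    simpa using is_const_of_deriv_eq_zero (fun s => (hderiv s).differentiableAt)
      (fun s => (hderiv s).deriv) s 0
  exact tendsto_nhds_unique tendsto_const_nhds (by simpa only [hconst] using hlim)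

end RadialEquation

section Asymptotics

variable {n : ℕ} {A : Configuration n} {ξ : Fin n → ℝ}

theorem Am_toComplex_ne_zero (hξ : ∀ α ∈ A.vectors, ξ ⬝ᵥ α ≠ 0) : A.Am (toComplex ξ) ≠ 0 :=
  Finset.prod_ne_zero_iff.2 fun α hα => pow_ne_zero _ <| by
    rw [toComplex_dotProduct]
    exact Complex.ofReal_ne_zero.2 (hξ α hα)

theorem sq_im_le_norm_im_add_mul (w : ℂ) (t : ℝ) : w.im ^ 2 ≤ ‖(w.im : ℂ) + t * w‖ * ‖w‖ := by
  have him : (((w.im : ℂ) + t * w) * starRingEnd ℂ w).im = -w.im ^ 2 := by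
    simp
    ring
  calc w.im ^ 2 = |(((w.im : ℂ) + t * w) * starRingEnd ℂ w).im| := by
        rw [him, abs_neg, abs_of_nonneg (sq_nonneg _)]
    _ ≤ _ := (Complex.abs_im_le_norm _).trans_eq (by rw [norm_mul, Complex.norm_conj])

theorem sq_le_norm_add_smul_shift_dotProduct (t : ℝ) (y α : Fin n → ℝ) :
    (ξ ⬝ᵥ α) ^ 2 ≤ ‖(toComplex ξ + (t : ℂ) • shift ξ y) ⬝ᵥ toComplex α‖ *
      ‖shift ξ y ⬝ᵥ toComplex α‖ := by
  have him : (shift ξ y ⬝ᵥ toComplex α).im = ξ ⬝ᵥ α := by simp [shift_dotProduct_toComplex]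
  rw [add_dotProduct, toComplex_dotProduct, smul_dotProduct, smul_eq_mul, ← him]
  exact sq_im_le_norm_im_add_mul _ _

theorem expGrowth_inv_Am_add_smul {S : Set ℝ} (hξ : ∀ α ∈ A.vectors, ξ ⬝ᵥ α ≠ 0) :
    ExpGrowth S (Set.range (shift ξ)) fun t z => (A.Am (toComplex ξ + (t : ℂ) • z))⁻¹ := by
  refine ExpGrowth.inv_Am (u := fun (t : ℝ) z => toComplex ξ + (t : ℂ) • z) fun α hα => ?_
  have hcont : ∀ t : ℝ, Continuous fun z : Fin n → ℂ =>
      (toComplex ξ + (t : ℂ) • z) ⬝ᵥ toComplex α := fun t =>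
    Continuous.dotProduct (by fun_prop) continuous_const
  have hpos : 0 < (ξ ⬝ᵥ α) ^ 2 := sq_pos_of_ne_zero (hξ α hα)
  have hnorm : ∀ (t : ℝ) (y : Fin n → ℝ),
      0 < ‖(toComplex ξ + (t : ℂ) • shift ξ y) ⬝ᵥ toComplex α‖ := fun t y =>
    pos_of_mul_pos_left (hpos.trans_le (sq_le_norm_add_smul_shift_dotProduct t y α))
      (norm_nonneg _)
  refine ExpGrowth.of_norm_le_mul_norm (R := n * ‖toComplex α‖ / (ξ ⬝ᵥ α) ^ 2)
    (fun t _ => (hcont t).continuousOn.inv₀ ?_) ?_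
  · rintro _ ⟨y, rfl⟩
    exact norm_pos_iff.1 (hnorm t y)
  · rintro t _ _ ⟨y, rfl⟩
    rw [norm_inv, inv_le_iff_one_le_mul₀' (hnorm t y), div_mul_eq_mul_div, mul_div_assoc',
      one_le_div hpos]
    exact (sq_le_norm_add_smul_shift_dotProduct t y α).trans
      (mul_le_mul_of_nonneg_left (norm_dotProduct_le_card_mul _ _) (norm_nonneg _))

/-- The function `t^(2|m|) p(x / t²) / A_m(x)²` of `z`, where `x = ξ + t z`, for `p` of degree at
most `|m|`. Expanding `p` into homogeneous components makes it meaningful at `t = 0`; it is the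
integrand with `t = 1 / s` after the Gaussian is translated by `s ξ`. -/
def blowUp (A : Configuration n) (ξ : Fin n → ℝ) (p : MvPolynomial (Fin n) ℂ) (t : ℝ)
    (z : Fin n → ℂ) : ℂ :=
  (∑ k ∈ Finset.range (A.totalMult + 1), ((t : ℂ) ^ 2) ^ (A.totalMult - k) *
    eval (toComplex ξ + (t : ℂ) • z) (homogeneousComponent k p)) *
    (A.Am (toComplex ξ + (t : ℂ) • z))⁻¹ ^ 2

theorem blowUp_zero (p : MvPolynomial (Fin n) ℂ) (z : Fin n → ℂ) : blowUp A ξ p 0 z =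
    eval (toComplex ξ) (homogeneousComponent A.totalMult p) * (A.Am (toComplex ξ))⁻¹ ^ 2 := by
  have hlower : ∀ k ∈ Finset.range A.totalMult,
      ((0 : ℂ) ^ 2) ^ (A.totalMult - k) * eval (toComplex ξ) (homogeneousComponent k p) = 0 := by
    intro k hk
    rw [zero_pow two_ne_zero, zero_pow (Nat.sub_ne_zero_of_lt (Finset.mem_range.1 hk)), zero_mul]
  rw [blowUp, Complex.ofReal_zero, zero_smul, add_zero, Finset.sum_range_succ,
    Finset.sum_eq_zero hlower, zero_add, Nat.sub_self, pow_zero, one_mul]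

theorem expGrowth_blowUp (hξ : ∀ α ∈ A.vectors, ξ ⬝ᵥ α ≠ 0) (p : MvPolynomial (Fin n) ℂ) {S : Set ℝ}
    {R : ℝ} (hS : ∀ t ∈ S, |t| ≤ R) :
    ExpGrowth S (Set.range (shift ξ)) (blowUp A ξ p) :=
  (ExpGrowth.sum fun _ => (((ExpGrowth.param hS).pow 2).pow _).mul (ExpGrowth.eval (fun i =>
    (ExpGrowth.const _).add ((ExpGrowth.param hS).mul (ExpGrowth.coord i))) _)).mul
    ((expGrowth_inv_Am_add_smul hξ).pow 2)

theorem continuousAt_blowUp (hξ : A.Am (toComplex ξ) ≠ 0) (p : MvPolynomial (Fin n) ℂ)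
    (z : Fin n → ℂ) : ContinuousAt (fun t => blowUp A ξ p t z) 0 := by
  have hline : Continuous fun t : ℝ => toComplex ξ + (t : ℂ) • z := by fun_prop
  have heval : ∀ q : MvPolynomial (Fin n) ℂ,
      Continuous fun t : ℝ => eval (toComplex ξ + (t : ℂ) • z) q :=
    fun q => (continuous_eval q).comp hline
  refine (continuous_finsetSum _ fun k _ => ?_).continuousAt.mul (ContinuousAt.pow ?_ 2)
  · exact ((Complex.continuous_ofReal.pow 2).pow _).mul (heval _)
  · simp only [← A.eval_AmPoly]
    exact (heval _).continuousAt.inv₀ (by simpa [A.eval_AmPoly] using hξ)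

theorem gaussianIntegral_weightedExp_eq_blowUp {p : MvPolynomial (Fin n) ℂ}
    (hp : p.totalDegree ≤ A.totalMult) {s : ℝ} (hs : s ≠ 0) :
    gaussianIntegral ξ (weightedExp A ((s : ℂ) • toComplex ξ) (rescale (s : ℂ) p)) =
      Complex.exp (s ^ 2 * (toComplex ξ ⬝ᵥ toComplex ξ) / 2) *
        gaussianIntegral ξ (blowUp A ξ p s⁻¹) := by
  have hs' : (s : ℂ) ≠ 0 := Complex.ofReal_ne_zero.2 hs
  have hsplit : weightedExp A ((s : ℂ) • toComplex ξ) (rescale (s : ℂ) p) = fun z =>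
      eval ((s : ℂ) • z) p * (A.Am z)⁻¹ ^ 2 * Complex.exp (z ⬝ᵥ toComplex (s • ξ)) := by
    funext z
    rw [weightedExp, eval_rescale, toComplex_smul, mul_right_comm]
  rw [hsplit, gaussianIntegral_mul_exp_dotProduct ξ (s • ξ)
    (fun z => eval ((s : ℂ) • z) p * (A.Am z)⁻¹ ^ 2), toComplex_dotProduct ξ ξ, smul_dotProduct,
    dotProduct_smul]
  congr 1
  · simp only [smul_eq_mul, Complex.ofReal_mul, sq, mul_assoc]
  refine gaussianIntegral_congr fun y => ?_
  set x := toComplex ξ + ((s⁻¹ : ℝ) : ℂ) • shift ξ y with hx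
  have hshift : shift ξ y + toComplex (s • ξ) = (s : ℂ) • x := by
    rw [hx, smul_add, smul_smul, Complex.ofReal_inv, mul_inv_cancel₀ hs', one_smul, add_comm,
      toComplex_smul]
  rw [hshift, smul_smul, eval_smul_eq_sum hp, Am_smul, blowUp, Finset.sum_mul, Finset.sum_mul]
  refine Finset.sum_congr rfl fun k hk => ?_
  have hpow : (s : ℂ) ^ A.totalMult = (s : ℂ) ^ (A.totalMult - k) * (s : ℂ) ^ k := by
    rw [← pow_add, Nat.sub_add_cancel (Nat.lt_succ_iff.1 (Finset.mem_range.1 hk))]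
  rw [← hx]
  simp only [hpow, Complex.ofReal_inv, inv_pow]
  field_simp
  ring

theorem tendsto_gaussianIntegral_weightedExp (hξ : ∀ α ∈ A.vectors, ξ ⬝ᵥ α ≠ 0)
    {p : MvPolynomial (Fin n) ℂ} (hp : p.totalDegree ≤ A.totalMult) :
    Tendsto (fun s : ℝ => Complex.exp (-(s ^ 2 * (toComplex ξ ⬝ᵥ toComplex ξ) / 2)) *
        gaussianIntegral ξ (weightedExp A ((s : ℂ) • toComplex ξ) (rescale (s : ℂ) p))) atTop
      (𝓝 (eval (toComplex ξ) (homogeneousComponent A.totalMult p) *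
        (A.Am (toComplex ξ))⁻¹ ^ 2)) := by
  have hblowUp : Tendsto (fun t => gaussianIntegral ξ (blowUp A ξ p t)) (𝓝 0)
      (𝓝 (gaussianIntegral ξ (blowUp A ξ p 0))) :=
    (expGrowth_blowUp (S := Metric.closedBall 0 1) hξ p fun t ht => by
      simpa using ht).tendsto_gaussianIntegral (Metric.closedBall_mem_nhds 0 one_pos)
        (continuousAt_blowUp (Am_toComplex_ne_zero hξ) p)
  have hzero : gaussianIntegral ξ (blowUp A ξ p 0) =
      eval (toComplex ξ) (homogeneousComponent A.totalMult p) * (A.Am (toComplex ξ))⁻¹ ^ 2 := by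
    rw [← mul_one (_ * _), ← gaussianIntegral_one ξ, ← gaussianIntegral_const_mul]
    exact gaussianIntegral_congr fun y => by rw [blowUp_zero, mul_one]
  rw [← hzero]
  refine (hblowUp.comp tendsto_inv_atTop_zero).congr' ?_
  filter_upwards [eventually_ne_atTop 0] with s hs
  rw [gaussianIntegral_weightedExp_eq_blowUp hp hs, ← mul_assoc, ← Complex.exp_add, neg_add_cancel,
    Complex.exp_zero, one_mul, Function.comp_apply]

end Asymptotics

namespace IsBakerAkhiezerPolynomial

variable {n : ℕ} {A : Configuration n} {F : MvPolynomial (Fin n) (MvPolynomial (Fin n) ℂ)}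
  (hF : IsBakerAkhiezerPolynomial A F)

include hF

theorem totalDegree_eval_C_le (x : Fin n → ℂ) : (eval (C ∘ x) F).totalDegree ≤ A.totalMult := by
  by_contra! hlt
  have hne : eval (C ∘ x) F ≠ 0 := fun h => by simp [h] at hlt
  refine homogeneousComponent_totalDegree_ne_zero hne (MvPolynomial.funext fun l => ?_)
  rw [hF.homogeneousComponent_eval_C,
    homogeneousComponent_eq_zero _ _ ((hF.totalDegree_map_eval_le l).trans_lt hlt), map_zero,
    map_zero]

theorem eval_homogeneousComponent_totalMult_eval_C (x : Fin n → ℂ) :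
    eval x (homogeneousComponent A.totalMult (eval (C ∘ x) F)) = A.Am x ^ 2 := by
  rw [hF.homogeneousComponent_eval_C, hF.homogeneousComponent_map_eval, map_mul, eval_C,
    A.eval_AmPoly, sq]

theorem rescale_eval_C {t : ℝ} (ht : t ≠ 0) (x : Fin n → ℂ) :
    rescale (t : ℂ) (eval (C ∘ x) F) = eval (C ∘ ((t : ℂ) • x)) F :=
  MvPolynomial.funext fun l => by rw [hF.eval_C_smul ht, eval_rescale]

theorem spectralDefect_eval_C (h0 : eval 0 (map (eval 0) F) ≠ 0) (x : Fin n → ℂ) :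
    spectralDefect A x (eval (C ∘ x) F) = 0 := by
  rw [← eval_spectralOperator, hF.spectralOperator_eq_zero h0, map_zero]

theorem map_eval_zero_mul_gaussianIntegral {ξ : Fin n → ℝ} (hξ : ∀ α ∈ A.vectors, ξ ⬝ᵥ α ≠ 0)
    (h0 : eval 0 (map (eval 0) F) ≠ 0) :
    eval 0 (map (eval 0) F) * gaussianIntegral ξ (fun z => 1 / A.Am z ^ 2) = 1 := by
  have hlim := tendsto_gaussianIntegral_weightedExp hξ (hF.totalDegree_eval_C_le (toComplex ξ))
  rw [hF.eval_homogeneousComponent_totalMult_eval_C, ← mul_pow,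
    mul_inv_cancel₀ (Am_toComplex_ne_zero hξ), one_pow] at hlim
  have hode := eq_of_hasDerivAt_mul_of_tendsto
    (hasDerivAt_gaussianIntegral_weightedExp_of_spectralDefect_eq_zero hξ fun t ht => by
      rw [hF.rescale_eval_C ht, hF.spectralDefect_eval_C h0])
    (by simpa only [mul_div_assoc] using hlim)
  rw [← gaussianIntegral_const_mul]
  refine (gaussianIntegral_congr fun y => ?_).trans hode
  rw [weightedExp, eval_rescale, Complex.ofReal_zero, zero_smul, hF.eval_zero_eval_C _ 0, zero_smul,
    dotProduct_zero, Complex.exp_zero, mul_one, one_div, inv_pow]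

end IsBakerAkhiezerPolynomial

theorem gaussianIntegrable_one_div_Am_sq {n : ℕ} {A : Configuration n} {ξ : Fin n → ℝ}
    (hξ : ∀ α ∈ A.vectors, ξ ⬝ᵥ α ≠ 0) : GaussianIntegrable ξ fun z => 1 / A.Am z ^ 2 := by
  simpa only [one_div, inv_pow] using
    ((expGrowth_inv_Am (S := (Set.univ : Set Unit)) hξ).pow 2).gaussianIntegrable (Set.mem_univ ())

end BakerAkhiezer

end

theorem mainTheorem2 {n : ℕ} (A : BakerAkhiezer.Configuration n)
    (φ : (Fin n → ℂ) → (Fin n → ℂ) → ℂ) (hφ : BakerAkhiezer.IsBakerAkhiezer A φ)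
    (h0 : φ 0 0 ≠ 0) (ξ : Fin n → ℝ) (hξ : ∀ α ∈ A.vectors, ξ ⬝ᵥ α ≠ 0) :
    BakerAkhiezer.GaussianIntegrable ξ (fun x => 1 / A.Am x ^ 2) ∧
      φ 0 0 = (BakerAkhiezer.gaussianIntegral ξ (fun x => 1 / A.Am x ^ 2))⁻¹ := by
  obtain ⟨F, hF, hφF⟩ := hφ.exists_polynomial
  have hφ00 : φ 0 0 = MvPolynomial.eval 0 (MvPolynomial.map (MvPolynomial.eval 0) F) := by
    rw [hφF, zero_dotProduct, Complex.exp_zero, mul_one]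
  rw [hφ00] at h0 ⊢
  exact ⟨BakerAkhiezer.gaussianIntegrable_one_div_Am_sq hξ,
    eq_inv_of_mul_eq_one_left (hF.map_eval_zero_mul_gaussianIntegral hξ h0)⟩
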